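/- Let $T$ be a compact connected Lie group acting smoothly on a (finite-dimensional, Hausdorff, second countable) smooth manifold $M$ without boundary, and let $S\le T$ be any subgroup, not necessarily closed. For a subgroup $G\le T$ let $\Omega^\bullet(M)^G$ denote the complex of smooth real differential forms $\alpha$ on $M$ with $g^*\alpha=\alpha$ for all $g\in G$, with the exterior derivative $d$, and let $H^k(\Omega^\bullet(M)^G)$ be the space of closed forms in $\Omega^k(M)^G$ modulo $d\,\Omega^{k-1}(M)^G$ (where $\Omega^{-1}=0$); let $H^k(M)$ be the de Rham cohomology of $M$. Then for every $k\ge 0$ $$H^k(M)\;\simeq\; H^k(\Omega^\bullet(M)^S)\;\simeq\; H^k(\Omega^\bullet(M)^T)$$ as real vector spaces. More precisely, the inclusions of complexes $\Omega^\bullet(M)^T\subseteq\Omega^\bullet(M)^S\subseteq\Omega^\bullet(M)$ induce linear isomorphisms $H^k(\Omega^\bullet(M)^T)\to H^k(\Omega^\bullet(M)^S)$ and $H^k(\Omega^\bullet(M)^S)\to H^k(M)$. -/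

import Mathlib

open scoped Manifold ContDiff Topology

noncomputable section

namespace DeRham

section Forms

variable {E : Type*} [NormedAddCommGroup E] [NormedSpace ℝ E]
  {M : Type*} [TopologicalSpace M] [ChartedSpace E M]
  {E' : Type*} [NormedAddCommGroup E'] [NormedSpace ℝ E']
  {N : Type*} [TopologicalSpace N] [ChartedSpace E' N]
  {E'' : Type*} [NormedAddCommGroup E''] [NormedSpace ℝ E'']
  {P : Type*} [TopologicalSpace P] [ChartedSpace E'' P] {k : ℕ}

variable (E M) in
/-- Not necessarily smooth real differential `k`-forms on the manifold `M` (without boundary,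
modelled on `E`): a choice of an alternating `k`-linear form on each tangent space. -/
abbrev RawForm (k : ℕ) : Type _ :=
  ∀ x : M, TangentSpace 𝓘(ℝ, E) x [⋀^Fin k]→L[ℝ] ℝ

/-- The pullback `f^* α` of a form, `(f^* α)_x (v₁, …, v_k) = α_{f x} (df_x v₁, …, df_x v_k)`. -/
def pullback (f : M → N) (α : RawForm E' N k) : RawForm E M k :=
  fun x ↦ (α (f x)).compContinuousLinearMap (mfderiv 𝓘(ℝ, E) 𝓘(ℝ, E') f x)

/-- The expression of a form in the chart around `x₀`: its pullback by the inverse of the chart,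
viewed as a form on the vector space `E` (meaningful on the target of the chart). -/
def inChart (x₀ : M) (α : RawForm E M k) : E → E [⋀^Fin k]→L[ℝ] ℝ :=
  pullback (E := E) (M := E) (chartAt E x₀).symm α

/-- A form is smooth if its expression in each chart is `C^∞`. -/
def IsSmooth (α : RawForm E M k) : Prop :=
  ∀ x₀ : M, ContDiffOn ℝ ∞ (inChart x₀ α) (chartAt E x₀).target

/-- The exterior derivative: at `x`, it is the exterior derivative of the expression of the form
in the chart around `x`, carried back to the tangent space at `x` by the chart. For smooth forms
the charts around other points give the same result, see `inChart_rawD`. -/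
def rawD (α : RawForm E M k) : RawForm E M (k + 1) :=
  fun x ↦ (extDeriv (inChart x α) (chartAt E x x)).compContinuousLinearMap
    (mfderiv 𝓘(ℝ, E) 𝓘(ℝ, E) (chartAt E x) x)

theorem pullback_add (f : M → N) (α β : RawForm E' N k) :
    pullback (E := E) f (α + β) = pullback f α + pullback f β := rfl

theorem pullback_smul (f : M → N) (c : ℝ) (α : RawForm E' N k) :
    pullback (E := E) f (c • α) = c • pullback f α := rfl

theorem pullback_zero (f : M → N) :
    pullback (E := E) f (0 : RawForm E' N k) = 0 := rfl

theorem pullback_comp_apply {f : N → P} {g : M → N} {x : M}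
    (hf : MDifferentiableAt 𝓘(ℝ, E') 𝓘(ℝ, E'') f (g x))
    (hg : MDifferentiableAt 𝓘(ℝ, E) 𝓘(ℝ, E') g x) (α : RawForm E'' P k) :
    pullback (E := E) (f ∘ g) α x = pullback (E := E) g (pullback (E := E') f α) x := by
  simp only [pullback]
  rw [mfderiv_comp x hf hg]
  rfl

theorem pullback_congr {f g : M → N} {x : M} (h : f =ᶠ[𝓝 x] g) (α : RawForm E' N k) :
    pullback (E := E) f α x = pullback (E := E) g α x := by
  have h1 := h.mfderiv_eq (I := 𝓘(ℝ, E)) (I' := 𝓘(ℝ, E'))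
  have h2 := h.self_of_nhds
  ext v
  simp only [pullback, ContinuousAlternatingMap.compContinuousLinearMap_apply]
  rw [h1]
  revert h2
  generalize mfderiv 𝓘(ℝ, E) 𝓘(ℝ, E') g x = L
  intro h2
  change (show E' [⋀^Fin k]→L[ℝ] ℝ from α (f x)) _ = (show E' [⋀^Fin k]→L[ℝ] ℝ from α (g x)) _
  rw [h2]

theorem inChart_add (x₀ : M) (α β : RawForm E M k) :
    inChart x₀ (α + β) = inChart x₀ α + inChart x₀ β := rfl

theorem inChart_smul (x₀ : M) (c : ℝ) (α : RawForm E M k) :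
    inChart x₀ (c • α) = c • inChart x₀ α := rfl

variable [IsManifold 𝓘(ℝ, E) ∞ M]

theorem contMDiffAt_chart {x₀ x : M} (hx : x ∈ (chartAt E x₀).source) :
    ContMDiffAt 𝓘(ℝ, E) 𝓘(ℝ, E) ∞ (chartAt E x₀) x :=
  contMDiffOn_chart.contMDiffAt ((chartAt E x₀).open_source.mem_nhds hx)

theorem contMDiffAt_chart_symm {x₀ : M} {y : E} (hy : y ∈ (chartAt E x₀).target) :
    ContMDiffAt 𝓘(ℝ, E) 𝓘(ℝ, E) ∞ (chartAt E x₀).symm y :=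
  contMDiffOn_chart_symm.contMDiffAt ((chartAt E x₀).open_target.mem_nhds hy)

/-- Exterior derivative commutes with pullback by a smooth map from a vector space. -/
theorem extDeriv_pullback_eq {α : RawForm E M k} (hα : IsSmooth α) {g : E' → M} {y : E'}
    (hg : ContMDiffAt 𝓘(ℝ, E') 𝓘(ℝ, E) ∞ g y) :
    extDeriv (𝕜 := ℝ) (E := E') (F := ℝ) (pullback (E := E') (M := E') g α) y =
      pullback (E := E') (M := E') g (rawD α) y := by
  set x := g y with hx
  set e := chartAt E x with he
  have hxs : g y ∈ e.source := mem_chart_source E x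
  have hev : ∀ᶠ z in 𝓝 y, g z ∈ e.source := hg.continuousAt (e.open_source.mem_nhds hxs)
  have hsm : ∀ᶠ z in 𝓝 y, ContMDiffAt 𝓘(ℝ, E') 𝓘(ℝ, E) 1 g z := by
    have : IsManifold 𝓘(ℝ, E) 1 M := .of_le (n := ∞) ENat.LEInfty.out
    exact (contMDiffAt_iff_contMDiffAt_nhds (by simp)).1 (hg.of_le ENat.LEInfty.out)
  have hcomp : ContMDiffAt 𝓘(ℝ, E') 𝓘(ℝ, E) ∞ (e ∘ g) y :=
    (contMDiffAt_chart hxs).comp y hg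
  have hloc : (pullback (E := E') (M := E') g α) =ᶠ[𝓝 y]
      fun z ↦ (inChart x α ((e ∘ g) z)).compContinuousLinearMap (fderiv ℝ (e ∘ g) z) := by
    filter_upwards [hev.eventually_nhds, hsm] with z hz hgz
    have hzs : g z ∈ e.source := hz.self_of_nhds
    have h1 : g =ᶠ[𝓝 z] e.symm ∘ (e ∘ g) := by
      filter_upwards [hz] with w hw
      exact (e.left_inv hw).symm
    rw [pullback_congr h1, pullback_comp_apply (E' := E)]
    · simp only [pullback, inChart, mfderiv_eq_fderiv]
      rfl
    · exact (contMDiffAt_chart_symm (e.map_source hzs)).mdifferentiableAt (by simp)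
    · exact (((contMDiffAt_chart hzs).of_le ENat.LEInfty.out).comp z hgz).mdifferentiableAt (by simp)
  rw [hloc.extDeriv_eq, extDeriv_pullback (r := ∞)]
  · have : mfderiv 𝓘(ℝ, E') 𝓘(ℝ, E) (e ∘ g) y = _ :=
      mfderiv_comp y ((contMDiffAt_chart hxs).mdifferentiableAt (by simp))
      (hg.mdifferentiableAt (by simp))
    rw [mfderiv_eq_fderiv] at this
    rw [this]
    rfl
  · exact ((hα x).contDiffAt (e.open_target.mem_nhds (e.map_source hxs))).differentiableAt
      (by simp)
  · exact hcomp.contDiffAt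
  · rw [minSmoothness_of_isRCLikeNormedField]; exact ENat.LEInfty.out

/-- In every chart, the exterior derivative is given by the usual exterior derivative. -/
theorem inChart_rawD {α : RawForm E M k} (hα : IsSmooth α) (x₀ : M) :
    Set.EqOn (inChart x₀ (rawD α)) (extDeriv (inChart x₀ α)) (chartAt E x₀).target :=
  fun _ hy ↦ (extDeriv_pullback_eq hα (contMDiffAt_chart_symm hy)).symm

theorem IsSmooth.rawD {α : RawForm E M k} (hα : IsSmooth α) : IsSmooth (rawD α) := by
  intro x₀
  refine ContDiffOn.congr ?_ (inChart_rawD hα x₀)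
  have h := (hα x₀).fderiv_of_isOpen (m := ∞) (chartAt E x₀).open_target (by simp)
  exact (ContinuousAlternatingMap.alternatizeUncurryFinCLM ℝ E ℝ).contDiff.comp_contDiffOn h

theorem rawD_rawD {α : RawForm E M k} (hα : IsSmooth α) : DeRham.rawD (DeRham.rawD α) = 0 := by
  funext x
  have hx : chartAt E x x ∈ (chartAt E x).target := (chartAt E x).map_source (mem_chart_source E x)
  have hn := (chartAt E x).open_target.mem_nhds hx
  have h1 : inChart x (DeRham.rawD α) =ᶠ[𝓝 (chartAt E x x)] extDeriv (inChart x α) := by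
    filter_upwards [hn] with y hy using inChart_rawD hα x hy
  rw [DeRham.rawD, h1.extDeriv_eq, extDeriv_extDeriv_apply ((hα x).contDiffAt hn)]
  · rfl
  · rw [minSmoothness_of_isRCLikeNormedField]; exact ENat.LEInfty.out

/-- Naturality of the exterior derivative. -/
theorem rawD_pullback [IsManifold 𝓘(ℝ, E') ∞ N] {α : RawForm E' N k} (hα : IsSmooth α) {f : M → N}
    (hf : ContMDiff 𝓘(ℝ, E) 𝓘(ℝ, E') ∞ f) :
    DeRham.rawD (pullback (E := E) f α) = pullback f (DeRham.rawD α) := by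
  funext x
  set e := chartAt E x with he
  have hxs : x ∈ e.source := mem_chart_source E x
  have hx : e x ∈ e.target := e.map_source hxs
  have h1 : inChart x (pullback (E := E) f α) =ᶠ[𝓝 (e x)]
      pullback (E := E) (M := E) (f ∘ e.symm) α := by
    filter_upwards [e.open_target.mem_nhds hx] with y hy
    exact (pullback_comp_apply ((hf _).mdifferentiableAt (by simp))
      ((contMDiffAt_chart_symm hy).mdifferentiableAt (by simp)) α).symm
  have h2 : ContMDiffAt 𝓘(ℝ, E) 𝓘(ℝ, E') ∞ (f ∘ e.symm) (e x) :=
    (hf _).comp _ (contMDiffAt_chart_symm hx)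
  have h3 : f =ᶠ[𝓝 x] (f ∘ e.symm) ∘ e := by
    filter_upwards [e.open_source.mem_nhds hxs] with z hz
    simp [e.left_inv hz]
  rw [pullback_congr h3, pullback_comp_apply (E' := E) (h2.mdifferentiableAt (by simp))
    ((contMDiffAt_chart hxs).mdifferentiableAt (by simp)), DeRham.rawD, h1.extDeriv_eq,
    extDeriv_pullback_eq hα h2]
  rfl

variable (E M) in
/-- The space `Ω^k(M)` of smooth real differential `k`-forms. -/
def Form (k : ℕ) : Submodule ℝ (RawForm E M k) where
  carrier := {α | IsSmooth α}
  zero_mem' := fun _ ↦ contDiffOn_const (c := 0)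
  add_mem' := fun ha hb x ↦ (ha x).add (hb x)
  smul_mem' := fun c _ ha x ↦ (ha x).const_smul c

instance instAddCommGroupForm (k : ℕ) : AddCommGroup (Form E M k) := Submodule.addCommGroup _

/-- The exterior derivative `d : Ω^k(M) → Ω^{k+1}(M)`. -/
def d (k : ℕ) : Form E M k →ₗ[ℝ] Form E M (k + 1) where
  toFun α := ⟨rawD α.1, IsSmooth.rawD α.2⟩
  map_add' α β := by
    ext1
    funext x
    have hn := (chartAt E x).open_target.mem_nhds ((chartAt E x).map_source (mem_chart_source E x))
    have ha := ((α.2 x).contDiffAt hn).differentiableAt (by simp)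
    have hb := ((β.2 x).contDiffAt hn).differentiableAt (by simp)
    simp only [rawD, Submodule.coe_add, Pi.add_apply, inChart_add, extDeriv_add ha hb]
    rfl
  map_smul' c α := by
    ext1
    funext x
    simp only [rawD, Submodule.coe_smul, Pi.smul_apply, inChart_smul, extDeriv_smul,
      RingHom.id_apply]
    rfl

theorem d_d (k : ℕ) : d (k + 1) ∘ₗ d k = (0 : Form E M k →ₗ[ℝ] Form E M (k + 2)) := by
  ext1 α
  exact Subtype.ext (rawD_rawD α.2)

end Forms

section Cohomology

variable {A : ℕ → Type*} [∀ k, AddCommGroup (A k)] [∀ k, Module ℝ (A k)]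
  {B : ℕ → Type*} [∀ k, AddCommGroup (B k)] [∀ k, Module ℝ (B k)]

/-- The coboundaries (exact elements) in degree `k` of a complex `A 0 → A 1 → A 2 → ⋯`. -/
def coboundaries (δ : ∀ k, A k →ₗ[ℝ] A (k + 1)) : ∀ k, Submodule ℝ (A k)
  | 0 => ⊥
  | k + 1 => LinearMap.range (δ k)

/-- The cohomology in degree `k` of a complex `A 0 → A 1 → A 2 → ⋯`: cocycles (closed elements)
modulo coboundaries (exact elements). -/
abbrev Cohomology (δ : ∀ k, A k →ₗ[ℝ] A (k + 1)) (k : ℕ) : Type _ :=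
  LinearMap.ker (δ k) ⧸ (coboundaries δ k).submoduleOf (LinearMap.ker (δ k))

theorem coboundaries_le_ker (δ : ∀ k, A k →ₗ[ℝ] A (k + 1)) (h : ∀ k, δ (k + 1) ∘ₗ δ k = 0) (k : ℕ) :
    coboundaries δ k ≤ LinearMap.ker (δ k) := by
  cases k with
  | zero => exact bot_le
  | succ k => exact LinearMap.range_le_ker_iff.2 (h k)

theorem coboundaries_map (δ : ∀ k, A k →ₗ[ℝ] A (k + 1)) (ε : ∀ k, B k →ₗ[ℝ] B (k + 1))
    (φ : ∀ k, A k →ₗ[ℝ] B k) (h : ∀ k, ε k ∘ₗ φ k = φ (k + 1) ∘ₗ δ k) (k : ℕ) :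
    coboundaries δ k ≤ (coboundaries ε k).comap (φ k) := by
  cases k with
  | zero => exact bot_le
  | succ k =>
    rintro _ ⟨a, rfl⟩
    exact ⟨φ k a, LinearMap.congr_fun (h k) a⟩

/-- The map induced in cohomology by a morphism of complexes. -/
def cohomologyMap (δ : ∀ k, A k →ₗ[ℝ] A (k + 1)) (ε : ∀ k, B k →ₗ[ℝ] B (k + 1))
    (φ : ∀ k, A k →ₗ[ℝ] B k) (h : ∀ k, ε k ∘ₗ φ k = φ (k + 1) ∘ₗ δ k) (k : ℕ) :
    Cohomology δ k →ₗ[ℝ] Cohomology ε k :=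
  Submodule.mapQ _ _
    ((φ k).restrict fun a (ha : δ k a = 0) ↦
      show ε k (φ k a) = 0 by
        rw [← LinearMap.comp_apply, h k, LinearMap.comp_apply, ha, map_zero])
    fun _ ha ↦ coboundaries_map δ ε φ h k ha

end Cohomology

section Invariant

variable (F : Type*) [NormedAddCommGroup F] [NormedSpace ℝ F]
  {T : Type*} [Group T] [TopologicalSpace T] [ChartedSpace F T]
  (E : Type*) [NormedAddCommGroup E] [NormedSpace ℝ E]
  (M : Type*) [TopologicalSpace M] [ChartedSpace E M] [IsManifold 𝓘(ℝ, E) ∞ M]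
  [MulAction T M]

/-- The de Rham cohomology `H^k(M)`. -/
abbrev DeRhamCohomology (k : ℕ) : Type _ :=
  Cohomology (A := fun k ↦ Form E M k) d k

/-- The space `Ω^k(M)^S` of the smooth `k`-forms that are invariant under the action of `S`. -/
def InvForm (S : Subgroup T) (k : ℕ) : Submodule ℝ (Form E M k) where
  carrier := {α | ∀ s ∈ S, pullback (fun x : M ↦ s • x) α.1 = α.1}
  zero_mem' := fun _ _ ↦ pullback_zero _
  add_mem' := fun {α β} ha hb s hs ↦ by
    rw [Submodule.coe_add, pullback_add, ha s hs, hb s hs]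
  smul_mem' := fun c α ha s hs ↦ by
    rw [Submodule.coe_smul, pullback_smul, ha s hs]

instance instAddCommGroupInvForm (S : Subgroup T) (k : ℕ) : AddCommGroup (InvForm E M S k) :=
  Submodule.addCommGroup _

variable [ContMDiffSMul 𝓘(ℝ, F) 𝓘(ℝ, E) ∞ T M] (S : Subgroup T)

/-- The exterior derivative of invariant forms, `d : Ω^k(M)^S → Ω^{k+1}(M)^S`. -/
def invD (k : ℕ) : InvForm E M S k →ₗ[ℝ] InvForm E M S (k + 1) :=
  (d k).restrict fun α hα s hs ↦ by
    have h := rawD_pullback α.2 (ContMDiffSMul.contMDiff_const_smul (I := 𝓘(ℝ, F))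
      (I' := 𝓘(ℝ, E)) (n := ∞) (M := M) s)
    rw [hα s hs] at h
    exact h.symm

/-- The cohomology `H^k(Ω^•(M)^S)` of the complex of `S`-invariant forms. -/
abbrev InvCohomology (k : ℕ) : Type _ :=
  Cohomology (A := fun k ↦ InvForm E M S k) (invD F E M S) k

/-- The map `H^k(Ω^•(M)^S) → H^k(M)` induced by the inclusion of complexes. -/
def invCohomologyToDeRham (k : ℕ) : InvCohomology F E M S k →ₗ[ℝ] DeRhamCohomology E M k :=
  cohomologyMap (A := fun k ↦ InvForm E M S k) (B := fun k ↦ Form E M k) (invD F E M S) d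
    (fun k ↦ (InvForm E M S k).subtype) (fun _ ↦ rfl) k

variable {S} in
/-- For `S ≤ S'`, the map `H^k(Ω^•(M)^{S'}) → H^k(Ω^•(M)^S)` induced by the inclusion. -/
def invCohomologyOfLE {S' : Subgroup T} (h : S ≤ S') (k : ℕ) :
    InvCohomology F E M S' k →ₗ[ℝ] InvCohomology F E M S k :=
  cohomologyMap (A := fun k ↦ InvForm E M S' k) (B := fun k ↦ InvForm E M S k)
    (invD F E M S') (invD F E M S)
    (fun _ ↦ Submodule.inclusion fun _ hα s hs ↦ hα s (h hs)) (fun _ ↦ rfl) k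

end Invariant

end DeRham

end

/-! The proof averages. Let `μ` be the invariant probability measure of the compact group
closure(S), regarded as a measure on T, and let A α = ∫ g^*α dμ(g). If A preserves smoothness,
commutes with d and moves closed forms only within their cohomology class, then H(Ω^S) → H(M) is
bijective. It is onto because A α is an S-invariant representative of the class of α. It is
injective because an S-invariant form a = dβ is fixed by A, so that a = d(A β) with A β invariant.
The same holds for ⊤, and the map from ⊤ to S follows by two-out-of-three.

These properties of A (`isGoodAverage`) hold for every finite measure on T, up to the total mass in
the last one; no density is needed, and the measure of a small subgroup is singular. For a measure
carried by a small chart ball, the ball is contracted linearly to its centre. The fundamental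
theorem of calculus and Cartan's formula (`rawD_contractPullback`) then give an explicit primitive
of the difference between the average and a multiple of the central translate
(`integralForm_translate_sub_mem_exactForms`). Dirac masses together with connectedness make all
translates of a closed form cohomologous (`translate_sub_mem_exactForms`). Compactness of T cuts a
general measure into finitely many small pieces. -/

open scoped Manifold ContDiff Topology
open MeasureTheory Set

noncomputable section

/-! ### Multilinear algebra: Cartan's formula and smoothness of linear pullback. -/

section Cartan

variable {E : Type*} [NormedAddCommGroup E] [NormedSpace ℝ E] {k : ℕ}

/-- Cartan's formula for the Lie derivative along a constant vector field. -/
theorem extDeriv_curryLeft_add {η : E → E [⋀^Fin (k + 1)]→L[ℝ] ℝ} {x : E}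
    (hη : DifferentiableAt ℝ η x) (Z : E) :
    extDeriv (fun y ↦ (η y).curryLeft Z) x + (extDeriv η x).curryLeft Z = fderiv ℝ η x Z := by
  have h : HasFDerivAt (fun y ↦ (η y).curryLeft Z)
      ((((ContinuousLinearMap.apply ℝ (E [⋀^Fin k]→L[ℝ] ℝ) Z).comp
        (ContinuousAlternatingMap.curryLeftLI (𝕜 := ℝ) (E := E) (F := ℝ)
          (n := k)).toContinuousLinearMap)).comp (fderiv ℝ η x)) x :=
    ((ContinuousLinearMap.apply ℝ (E [⋀^Fin k]→L[ℝ] ℝ) Z).comp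
        (ContinuousAlternatingMap.curryLeftLI (𝕜 := ℝ) (E := E) (F := ℝ)
          (n := k)).toContinuousLinearMap).hasFDerivAt.comp x hη.hasFDerivAt
  ext v
  rw [extDeriv, h.fderiv, extDeriv]
  simp only [ContinuousAlternatingMap.add_apply, ContinuousAlternatingMap.curryLeft_apply_apply,
    ContinuousAlternatingMap.alternatizeUncurryFin_apply]
  -- In the alternating sum for dη(Z, v) the term of index 0 is the derivative along Z. The others
  -- keep Z in front and have the sign opposite to the terms of d(ι_Z η), so they cancel.
  rw [Fin.sum_univ_succ (n := k + 1)]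
  have hr (i : Fin (k + 1)) : i.succ.removeNth (Matrix.vecCons Z v : Fin (k + 2) → E) =
      Matrix.vecCons Z (i.removeNth v) := by
    funext j
    refine Fin.cases ?_ (fun j ↦ ?_) j <;> simp [Fin.removeNth]
  simp [hr, pow_succ, Fin.removeNth_zero]

end Cartan

section Alternating

variable {E : Type*} [NormedAddCommGroup E] [NormedSpace ℝ E] [FiniteDimensional ℝ E]
  {F : Type*} [NormedAddCommGroup F] [NormedSpace ℝ F] {k : ℕ}

/-- Finite dimension makes every linear map out of this space continuous, in particular the
retraction `l` used below. -/
instance ContinuousMultilinearMap.finiteDimensional_real :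
    FiniteDimensional ℝ (ContinuousMultilinearMap ℝ (fun _ : Fin k ↦ E) ℝ) :=
  FiniteDimensional.of_injective
    (ContinuousMultilinearMap.toMultilinearMapLinear :
      ContinuousMultilinearMap ℝ (fun _ : Fin k ↦ E) ℝ →ₗ[ℝ] MultilinearMap ℝ (fun _ : Fin k ↦ E) ℝ)
    ContinuousMultilinearMap.toMultilinearMap_injective

/-- Pullback of alternating forms by linear maps is smooth in both arguments. -/
theorem ContinuousAlternatingMap.contDiff_compContinuousLinearMap :
    ContDiff ℝ ∞ (fun p : (F [⋀^Fin k]→L[ℝ] ℝ) × (E →L[ℝ] F) ↦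
      p.1.compContinuousLinearMap p.2) := by
  let ι := (ContinuousAlternatingMap.toContinuousMultilinearMapLI (𝕜 := ℝ) (E := E) (F := ℝ)
    (ι := Fin k)).toContinuousLinearMap
  -- Composing with a linear retraction onto the alternating maps reduces the claim to multilinear
  -- maps, where precomposition is itself continuous multilinear in the linear maps.
  obtain ⟨l, hl⟩ := ι.toLinearMap.exists_leftInverse_of_injective
    (LinearMap.ker_eq_bot.2 ContinuousAlternatingMap.toContinuousMultilinearMap_injective)
  have h : (fun p : (F [⋀^Fin k]→L[ℝ] ℝ) × (E →L[ℝ] F) ↦ p.1.compContinuousLinearMap p.2) =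
      fun p ↦ LinearMap.toContinuousLinearMap l
        (ContinuousMultilinearMap.compContinuousLinearMapContinuousMultilinear ℝ
          (fun _ : Fin k ↦ E) (fun _ : Fin k ↦ F) ℝ (fun _ ↦ p.2) p.1.toContinuousMultilinearMap) := by
    funext p
    exact (LinearMap.congr_fun hl (p.1.compContinuousLinearMap p.2)).symm
  rw [h]
  refine (LinearMap.toContinuousLinearMap l).contDiff.comp (ContDiff.clm_apply ?_ ?_)
  · exact (ContinuousMultilinearMap.contDiff _).comp (contDiff_pi.2 fun _ ↦ contDiff_snd)
  · exact (ContinuousAlternatingMap.toContinuousMultilinearMapLI (𝕜 := ℝ) (E := F) (F := ℝ)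
      (ι := Fin k)).contDiff.comp contDiff_fst

end Alternating

/-! ### Integrals depending smoothly on a parameter. -/

section ParametricIntegral

/-- Compact support is expressed throughout by a null complement, which admits singular measures
such as Dirac masses. -/
theorem ContinuousOn.integrable_of_measure_compl_eq_zero {W V : Type*} [TopologicalSpace W]
    [T2Space W] [SecondCountableTopology W] [MeasurableSpace W] [OpensMeasurableSpace W]
    {ν : Measure W} [IsFiniteMeasure ν] {K : Set W} [NormedAddCommGroup V] {f : W → V}
    (hf : ContinuousOn f K) (hK : IsCompact K) (hν : ν Kᶜ = 0) : Integrable f ν := by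
  have h := hf.integrableOn_compact (μ := ν) hK
  rwa [IntegrableOn, Measure.restrict_eq_self_of_ae_mem (mem_ae_iff.2 hν)] at h

theorem ContDiffOn.continuousOn_slice {W E V : Type*} [NormedAddCommGroup W] [NormedSpace ℝ W]
    [NormedAddCommGroup E] [NormedSpace ℝ E] [NormedAddCommGroup V] [NormedSpace ℝ V]
    {K O : Set W} {U : Set E} {G : W × E → V} (hKO : K ⊆ O)
    (hG : ContDiffOn ℝ ∞ G (O ×ˢ U)) {y : E} (hy : y ∈ U) :
    ContinuousOn (fun w ↦ G (w, y)) K :=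
  hG.continuousOn.comp (by fun_prop) fun _ hw ↦ ⟨hKO hw, hy⟩

/-- This partial derivative in the second variable is smooth on the same product, which keeps the
induction in `ContDiffOn.integral_nat` going. -/
theorem ContDiffOn.fderiv_comp_inr {W E V : Type*} [NormedAddCommGroup W] [NormedSpace ℝ W]
    [NormedAddCommGroup E] [NormedSpace ℝ E] [NormedAddCommGroup V] [NormedSpace ℝ V]
    {O : Set W} {U : Set E} {G : W × E → V} (hG : ContDiffOn ℝ ∞ G (O ×ˢ U)) (hO : IsOpen O)
    (hU : IsOpen U) :
    ContDiffOn ℝ ∞ (fun z ↦ (fderiv ℝ G z).comp (ContinuousLinearMap.inr ℝ W E)) (O ×ˢ U) :=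
  ((ContinuousLinearMap.compL ℝ E (W × E) V).flip
    (ContinuousLinearMap.inr ℝ W E)).contDiff.comp_contDiffOn
    (hG.fderiv_of_isOpen (hO.prod hU) (by simp))

universe u

variable {W : Type*} [NormedAddCommGroup W] [NormedSpace ℝ W] [SecondCountableTopology W]
  [MeasurableSpace W] [OpensMeasurableSpace W] {ν : Measure W} [IsFiniteMeasure ν] {K O : Set W}
  {E V : Type u} [NormedAddCommGroup E] [NormedSpace ℝ E] [FiniteDimensional ℝ E]
  [NormedAddCommGroup V] [NormedSpace ℝ V] {U : Set E}

/-- Differentiation under the integral sign for a smooth function. -/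
theorem ContDiffOn.hasFDerivAt_integral {G : W × E → V} (hO : IsOpen O) (hU : IsOpen U)
    (hK : IsCompact K) (hKO : K ⊆ O) (hν : ν Kᶜ = 0) (hG : ContDiffOn ℝ ∞ G (O ×ˢ U)) {y : E}
    (hy : y ∈ U) :
    HasFDerivAt (fun y ↦ ∫ w, G (w, y) ∂ν)
      (∫ w, (fderiv ℝ G (w, y)).comp (ContinuousLinearMap.inr ℝ W E) ∂ν) y := by
  have : ProperSpace E := FiniteDimensional.proper_real E
  obtain ⟨ε, hε, hεU⟩ := Metric.nhds_basis_closedBall.mem_iff.1 (hU.mem_nhds hy)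
  have hG' : ContDiffOn ℝ ∞ (fun z ↦ (fderiv ℝ G z).comp (ContinuousLinearMap.inr ℝ W E))
      (O ×ˢ U) :=
    hG.fderiv_comp_inr hO hU
  obtain ⟨C, hC⟩ := (hK.prod (isCompact_closedBall y ε)).exists_bound_of_continuousOn
    (hG'.continuousOn.mono (prod_mono hKO hεU))
  have hae : ∀ᵐ w ∂ν, w ∈ K := mem_ae_iff.2 hν
  refine hasFDerivAt_integral_of_dominated_of_fderiv_le (bound := fun _ ↦ C)
    (F' := fun y w ↦ (fderiv ℝ G (w, y)).comp (ContinuousLinearMap.inr ℝ W E))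
    (Metric.closedBall_mem_nhds y hε) ?_ ?_ ?_ ?_ (integrable_const C) ?_
  · filter_upwards [hU.mem_nhds hy] with z hz
    exact ((hG.continuousOn_slice hKO hz).integrable_of_measure_compl_eq_zero hK hν).1
  · exact (hG.continuousOn_slice hKO hy).integrable_of_measure_compl_eq_zero hK hν
  · exact ((hG'.continuousOn_slice hKO hy).integrable_of_measure_compl_eq_zero hK hν).1
  · filter_upwards [hae] with w hw z hz using hC (w, z) ⟨hw, hz⟩
  · filter_upwards [hae] with w hw z hz
    have h1 : HasFDerivAt G (fderiv ℝ G (w, z)) (w, z) :=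
      ((hG.contDiffAt ((hO.prod hU).mem_nhds ⟨hKO hw, hεU hz⟩)).differentiableAt
        (by simp)).hasFDerivAt
    exact h1.comp z (hasFDerivAt_prodMk_right w z)

/-- Each differentiation replaces `V` by `E →L[ℝ] V`. Hence `V` is quantified inside the statement
and shares a universe with `E`. -/
theorem ContDiffOn.integral_nat (n : ℕ) :
    ∀ {V : Type u} [NormedAddCommGroup V] [NormedSpace ℝ V] {G : W × E → V}, IsOpen O → IsOpen U →
    IsCompact K → K ⊆ O → ν Kᶜ = 0 → ContDiffOn ℝ ∞ G (O ×ˢ U) →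
    ContDiffOn ℝ n (fun y ↦ ∫ w, G (w, y) ∂ν) U := by
  induction n with
  | zero =>
    intro V _ _ G hO hU hK hKO hν hG
    exact contDiffOn_zero.2 fun y hy ↦
      (hG.hasFDerivAt_integral hO hU hK hKO hν hy).continuousAt.continuousWithinAt
  | succ n ih =>
    intro V _ _ G hO hU hK hKO hν hG
    have hG' : ContDiffOn ℝ ∞ (fun z ↦ (fderiv ℝ G z).comp (ContinuousLinearMap.inr ℝ W E))
        (O ×ˢ U) :=
      hG.fderiv_comp_inr hO hU
    have h := ih hO hU hK hKO hν hG'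
    push_cast
    rw [contDiffOn_succ_iff_fderiv_of_isOpen hU]
    refine ⟨fun y hy ↦ (hG.hasFDerivAt_integral hO hU hK hKO hν
      hy).differentiableAt.differentiableWithinAt, by simp, h.congr fun y hy ↦
      (hG.hasFDerivAt_integral hO hU hK hKO hν hy).fderiv⟩

/-- The integral of a smooth function depending smoothly on a parameter is smooth. -/
theorem ContDiffOn.integral {G : W × E → V} (hO : IsOpen O) (hU : IsOpen U)
    (hK : IsCompact K) (hKO : K ⊆ O) (hν : ν Kᶜ = 0) (hG : ContDiffOn ℝ ∞ G (O ×ˢ U)) :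
    ContDiffOn ℝ ∞ (fun y ↦ ∫ w, G (w, y) ∂ν) U :=
  contDiffOn_infty.2 fun n ↦ ContDiffOn.integral_nat n hO hU hK hKO hν hG

end ParametricIntegral

namespace DeRham

/-! ### Differential forms read in charts. -/

section Chart

variable {E : Type*} [NormedAddCommGroup E] [NormedSpace ℝ E]
  {M : Type*} [TopologicalSpace M] [ChartedSpace E M]
  {E' : Type*} [NormedAddCommGroup E'] [NormedSpace ℝ E']
  {N : Type*} [TopologicalSpace N] [ChartedSpace E' N]
  {E'' : Type*} [NormedAddCommGroup E''] [NormedSpace ℝ E'']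
  {P : Type*} [TopologicalSpace P] [ChartedSpace E'' P] {k : ℕ}

/-- The value of a form at a point, as an alternating form on the model space. -/
def RawForm.at (α : RawForm E M k) (x : M) : E [⋀^Fin k]→L[ℝ] ℝ := α x

/-- The form with given values on the model space. -/
def RawForm.ofModel (f : M → E [⋀^Fin k]→L[ℝ] ℝ) : RawForm E M k := f

/-- The derivative of a map, as a linear map between the model spaces. -/
def modelDeriv (f : M → N) (x : M) : E →L[ℝ] E' := mfderiv 𝓘(ℝ, E) 𝓘(ℝ, E') f x

theorem modelDeriv_comp {f : N → P} {g : M → N} {x : M}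
    (hf : MDifferentiableAt 𝓘(ℝ, E') 𝓘(ℝ, E'') f (g x))
    (hg : MDifferentiableAt 𝓘(ℝ, E) 𝓘(ℝ, E') g x) :
    modelDeriv (E := E) (E' := E'') (f ∘ g) x =
      (modelDeriv (E := E') (E' := E'') f (g x)).comp (modelDeriv (E := E) (E' := E') g x) :=
  mfderiv_comp x hf hg

theorem modelDeriv_eq_of_hasFDerivAt {f : E → E'} {L : E →L[ℝ] E'} {x : E} (h : HasFDerivAt f L x) :
    modelDeriv (E := E) (E' := E') f x = L := by
  rw [modelDeriv, mfderiv_eq_fderiv, h.fderiv]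

theorem pullback_at (f : M → N) (α : RawForm E' N k) (x : M) :
    (pullback (E := E) f α).at x =
      (α.at (f x)).compContinuousLinearMap (modelDeriv (E := E) (E' := E') f x) := rfl

theorem rawD_at (α : RawForm E M k) (x : M) :
    (rawD α).at x = (extDeriv (inChart x α) (chartAt E x x)).compContinuousLinearMap
      (modelDeriv (E := E) (E' := E) (chartAt E x) x) := rfl

theorem RawForm.ext_at {α β : RawForm E M k} (h : ∀ x, α.at x = β.at x) : α = β := funext h

variable [IsManifold 𝓘(ℝ, E) ∞ M]

/-- A form is recovered from its expression in a chart. -/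
theorem at_eq_inChart (α : RawForm E M k) {x₀ x : M} (hx : x ∈ (chartAt E x₀).source) :
    α.at x = (inChart x₀ α (chartAt E x₀ x)).compContinuousLinearMap
      (modelDeriv (E := E) (E' := E) (chartAt E x₀) x) := by
  have h1 : (id : M → M) =ᶠ[𝓝 x] (chartAt E x₀).symm ∘ (chartAt E x₀) := by
    filter_upwards [(chartAt E x₀).open_source.mem_nhds hx] with w hw
    exact ((chartAt E x₀).left_inv hw).symm
  have h2 := pullback_congr (E := E) h1 α
  rw [pullback_comp_apply (E' := E)
    ((contMDiffAt_chart_symm ((chartAt E x₀).map_source hx)).mdifferentiableAt (by simp))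
    ((contMDiffAt_chart hx).mdifferentiableAt (by simp))] at h2
  rw [pullback, mfderiv_id] at h2
  exact h2

/-- The pullback of a smooth form to a vector space is smooth. -/
theorem IsSmooth.contDiffAt_pullback [FiniteDimensional ℝ E'] {α : RawForm E M k}
    (hα : IsSmooth α) {g : E' → M} {y : E'}
    (hg : ContMDiffAt 𝓘(ℝ, E') 𝓘(ℝ, E) ∞ g y) :
    ContDiffAt ℝ ∞ (pullback (E := E') g α).at y := by
  set x := g y with hx
  set e := chartAt E x with he
  have hxs : g y ∈ e.source := mem_chart_source E x
  have hev : ∀ᶠ z in 𝓝 y, g z ∈ e.source := hg.continuousAt (e.open_source.mem_nhds hxs)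
  have hsm : ∀ᶠ z in 𝓝 y, ContMDiffAt 𝓘(ℝ, E') 𝓘(ℝ, E) 1 g z := by
    have : IsManifold 𝓘(ℝ, E) 1 M := .of_le (n := ∞) ENat.LEInfty.out
    exact (contMDiffAt_iff_contMDiffAt_nhds (by simp)).1 (hg.of_le ENat.LEInfty.out)
  have hcomp : ContDiffAt ℝ ∞ (e ∘ g) y := ((contMDiffAt_chart hxs).comp y hg).contDiffAt
  have hloc : (pullback (E := E') g α).at =ᶠ[𝓝 y]
      fun z ↦ (inChart x α ((e ∘ g) z)).compContinuousLinearMap (fderiv ℝ (e ∘ g) z) := by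
    filter_upwards [hev, hsm] with z hzs hgz
    have h2 := modelDeriv_comp (E := E') (E' := E) (E'' := E) (f := e) (g := g) (x := z)
      ((contMDiffAt_chart hzs).mdifferentiableAt (by simp)) (hgz.mdifferentiableAt (by simp))
    rw [pullback_at, at_eq_inChart α hzs, ← mfderiv_eq_fderiv]
    exact congrArg (fun L : E' →L[ℝ] E ↦
      (inChart x α ((e ∘ g) z)).compContinuousLinearMap L) h2.symm
  refine ContDiffAt.congr_of_eventuallyEq ?_ hloc
  have h3 : ContDiffAt ℝ ∞ (inChart x α) ((e ∘ g) y) :=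
    (hα x).contDiffAt (e.open_target.mem_nhds (e.map_source hxs))
  exact ContinuousAlternatingMap.contDiff_compContinuousLinearMap.contDiffAt.comp y
    ((h3.comp y hcomp).prodMk (hcomp.fderiv_right (m := ∞) (by simp)))

end Chart

/-! ### Integration of smooth families of forms. -/

section Family

universe u

/-- The pointwise integral of a family of forms. -/
def integralForm {E : Type*} [NormedAddCommGroup E] [NormedSpace ℝ E]
    {M : Type*} [TopologicalSpace M] [ChartedSpace E M] {k : ℕ}
    {Ω : Type*} [MeasurableSpace Ω] (μ : Measure Ω) (η : Ω → RawForm E M k) :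
    RawForm E M k :=
  RawForm.ofModel fun x ↦ ∫ a, (η a).at x ∂μ

variable {E : Type u} [NormedAddCommGroup E] [NormedSpace ℝ E]
  {M : Type*} [TopologicalSpace M] [ChartedSpace E M]
  {W : Type*} [NormedAddCommGroup W] [NormedSpace ℝ W] {k : ℕ}
  {O K : Set W} {η : W → RawForm E M k}

/-- A family of forms depending smoothly on a parameter in a subset of a vector space. -/
def IsSmoothFamily (O : Set W) (η : W → RawForm E M k) : Prop :=
  ∀ x₀ : M, ContDiffOn ℝ ∞ (fun z : W × E ↦ inChart x₀ (η z.1) z.2)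
    (O ×ˢ (chartAt E x₀).target)

variable [IsManifold 𝓘(ℝ, E) ∞ M]

theorem IsSmoothFamily.contDiffOn_apply (hη : IsSmoothFamily O η) (x : M) :
    ContDiffOn ℝ ∞ (fun w ↦ (η w).at x) O := by
  have hx := mem_chart_source E x
  have h1 : (fun w ↦ (η w).at x) =
      fun w ↦ ContinuousAlternatingMap.compContinuousLinearMapCLM
        (modelDeriv (E := E) (E' := E) (chartAt E x) x)
          (inChart x (η w) (chartAt E x x)) := by
    funext w
    exact at_eq_inChart (η w) hx
  rw [h1]
  refine (ContinuousLinearMap.contDiff _).comp_contDiffOn ?_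
  exact (hη x).comp (contDiff_id.prodMk contDiff_const).contDiffOn
    fun w hw ↦ ⟨hw, (chartAt E x).map_source hx⟩

variable [SecondCountableTopology W] [MeasurableSpace W] [OpensMeasurableSpace W]
  {ν : Measure W} [IsFiniteMeasure ν]

theorem IsSmoothFamily.integrable (hη : IsSmoothFamily O η) (hK : IsCompact K) (hKO : K ⊆ O)
    (hν : ν Kᶜ = 0) (x : M) :
    Integrable (fun w ↦ (η w).at x) ν :=
  ((hη.contDiffOn_apply x).continuousOn.mono hKO).integrable_of_measure_compl_eq_zero hK hν

/-- At a fixed `y`, passing to the chart is one fixed continuous linear map, so it commutes with the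
integral, even for `y` outside the chart target. -/
theorem IsSmoothFamily.inChart_integralForm (hη : IsSmoothFamily O η) (hK : IsCompact K)
    (hKO : K ⊆ O) (hν : ν Kᶜ = 0) (x₀ : M) (y : E) :
    inChart x₀ (integralForm ν η) y = ∫ w, inChart x₀ (η w) y ∂ν :=
  ((ContinuousAlternatingMap.compContinuousLinearMapCLM
    (modelDeriv (E := E) (E' := E) (chartAt E x₀).symm y)).integral_comp_comm
      (hη.integrable hK hKO hν ((chartAt E x₀).symm y))).symm

variable [FiniteDimensional ℝ E]

theorem IsSmoothFamily.isSmooth_integralForm (hη : IsSmoothFamily O η) (hO : IsOpen O)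
    (hK : IsCompact K) (hKO : K ⊆ O) (hν : ν Kᶜ = 0) : IsSmooth (integralForm ν η) := by
  intro x₀
  rw [funext (hη.inChart_integralForm hK hKO hν x₀)]
  exact (hη x₀).integral hO (chartAt E x₀).open_target hK hKO hν

/-- The exterior derivative commutes with the integration of families of forms. -/
theorem IsSmoothFamily.rawD_integralForm (hη : IsSmoothFamily O η) (hO : IsOpen O)
    (hK : IsCompact K) (hKO : K ⊆ O) (hν : ν Kᶜ = 0) :
    rawD (integralForm ν η) = integralForm ν (fun w ↦ rawD (η w)) := by
  refine RawForm.ext_at fun x ↦ ?_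
  have hx : chartAt E x x ∈ (chartAt E x).target := mem_chart_target E x
  have ho := (chartAt E x).open_target
  have h1 := (hη x).hasFDerivAt_integral hO ho hK hKO hν hx
  have hG : ContDiffOn ℝ ∞ (fun z ↦ (fderiv ℝ (fun z : W × E ↦ inChart x (η z.1) z.2) z).comp
      (ContinuousLinearMap.inr ℝ W E)) (O ×ˢ (chartAt E x).target) :=
    (hη x).fderiv_comp_inr hO ho
  have hint := (hG.continuousOn_slice hKO hx).integrable_of_measure_compl_eq_zero (ν := ν) hK hν
  -- The exterior derivative at `x` is a fixed continuous linear function `A` of the Fréchet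
  -- derivative of the chart expression, and both operations pass under the integral.
  let A := (ContinuousAlternatingMap.compContinuousLinearMapCLM (F := ℝ) (ι := Fin (k + 1))
    (modelDeriv (E := E) (E' := E) (chartAt E x) x)).comp
      (ContinuousAlternatingMap.alternatizeUncurryFinCLM ℝ E ℝ (n := k))
  have h2 : (rawD (integralForm ν η)).at x = A (fderiv ℝ (inChart x (integralForm ν η))
    (chartAt E x x)) := rfl
  have h4 : (integralForm ν fun w ↦ rawD (η w)).at x = ∫ w, (rawD (η w)).at x ∂ν := rfl
  rw [h2, h4, funext (hη.inChart_integralForm hK hKO hν x), h1.fderiv]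
  refine (ContinuousLinearMap.integral_comp_comm (𝕜 := ℝ) (E := E →L[ℝ] E [⋀^Fin k]→L[ℝ] ℝ)
    (Fₗ := E [⋀^Fin (k + 1)]→L[ℝ] ℝ) A hint).symm.trans (integral_congr_ae ?_)
  filter_upwards [mem_ae_iff.2 hν] with w hw
  have h3 : HasFDerivAt (inChart x (η w)) _ (chartAt E x x) :=
    (((hη x).contDiffAt ((hO.prod ho).mem_nhds ⟨hKO hw, hx⟩)).differentiableAt
        (by simp)).hasFDerivAt.comp _ (hasFDerivAt_prodMk_right w _)
  exact congrArg A h3.fderiv.symm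

end Family

/-! ### Families of translates, pulled back to a vector space by the orbit map. -/

section Orbit

/-- A family of translations of `M`, with the source read in the chart around `x₀`. -/
def orbitChart (E : Type*) [NormedAddCommGroup E] {M : Type*} [TopologicalSpace M]
    [ChartedSpace E M] {T : Type*} [SMul T M] {W : Type*} (σ : W → T) (x₀ : M) (z : W × E) : M :=
  σ z.1 • (chartAt E x₀).symm z.2

/-- The form `ι_ξ Φ^* α` restricted to the slice at `w`, where `Φ (w, x) = σ w • x`. -/
def contractPullback {E : Type*} [NormedAddCommGroup E] [NormedSpace ℝ E]
    {M : Type*} [TopologicalSpace M] [ChartedSpace E M] {T : Type*} [SMul T M]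
    {W : Type*} [NormedAddCommGroup W] [NormedSpace ℝ W] {k : ℕ}
    (σ : W → T) (w ξ : W) (α : RawForm E M (k + 1)) : RawForm E M k :=
  fun x ↦ ((α.at (σ w • x)).curryLeft
    (modelDeriv (E := W) (E' := E) (fun w ↦ σ w • x) w ξ)).compContinuousLinearMap
      (modelDeriv (E := E) (E' := E) (fun x : M ↦ σ w • x) x)

theorem mdifferentiableAt_const_smul (F : Type*) [NormedAddCommGroup F] [NormedSpace ℝ F]
    {T : Type*} [TopologicalSpace T] [ChartedSpace F T]
    {E : Type*} [NormedAddCommGroup E] [NormedSpace ℝ E]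
    {M : Type*} [TopologicalSpace M] [ChartedSpace E M] [SMul T M]
    [ContMDiffSMul 𝓘(ℝ, F) 𝓘(ℝ, E) ∞ T M] (g : T) (x : M) :
    MDifferentiableAt 𝓘(ℝ, E) 𝓘(ℝ, E) (fun x : M ↦ g • x) x :=
  (ContMDiffSMul.contMDiff_const_smul (I := 𝓘(ℝ, F)) (I' := 𝓘(ℝ, E)) (n := ∞) (M := M)
    g).mdifferentiableAt (by simp)

variable {F : Type*} [NormedAddCommGroup F] [NormedSpace ℝ F]
  {T : Type*} [Group T] [TopologicalSpace T] [ChartedSpace F T]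
  {E : Type*} [NormedAddCommGroup E] [NormedSpace ℝ E]
  {M : Type*} [TopologicalSpace M] [ChartedSpace E M] [IsManifold 𝓘(ℝ, E) ∞ M]
  [MulAction T M] [ContMDiffSMul 𝓘(ℝ, F) 𝓘(ℝ, E) ∞ T M]
  {W : Type*} [NormedAddCommGroup W] [NormedSpace ℝ W] {k : ℕ} {σ : W → T} {O : Set W}
  {x₀ : M} {w : W} {y : E}

theorem contMDiffAt_orbitChart (hO : IsOpen O) (hσ : ContMDiffOn 𝓘(ℝ, W) 𝓘(ℝ, F) ∞ σ O)
    (hw : w ∈ O) (hy : y ∈ (chartAt E x₀).target) :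
    ContMDiffAt 𝓘(ℝ, W × E) 𝓘(ℝ, E) ∞ (orbitChart E σ x₀) (w, y) := by
  have h1 : ContMDiffAt 𝓘(ℝ, W × E) 𝓘(ℝ, F) ∞ (fun z : W × E ↦ σ z.1) (w, y) :=
    ContMDiffAt.comp (w, y) (hσ.contMDiffAt (hO.mem_nhds hw)) contDiff_fst.contMDiff.contMDiffAt
  have h2 : ContMDiffAt 𝓘(ℝ, W × E) 𝓘(ℝ, E) ∞ (fun z : W × E ↦ (chartAt E x₀).symm z.2) (w, y) :=
    ContMDiffAt.comp (w, y) (contMDiffAt_chart_symm hy) contDiff_snd.contMDiff.contMDiffAt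
  exact h1.smul h2

theorem modelDeriv_orbitChart_inr (hO : IsOpen O) (hσ : ContMDiffOn 𝓘(ℝ, W) 𝓘(ℝ, F) ∞ σ O)
    (hw : w ∈ O) (hy : y ∈ (chartAt E x₀).target) :
    (modelDeriv (E := E) (E' := E) (fun x : M ↦ σ w • x) ((chartAt E x₀).symm y)).comp
      (modelDeriv (E := E) (E' := E) (chartAt E x₀).symm y) =
    (modelDeriv (E := W × E) (E' := E) (orbitChart E σ x₀) (w, y)).comp
      (ContinuousLinearMap.inr ℝ W E) := by
  have h1 := modelDeriv_comp (mdifferentiableAt_const_smul F (σ w) ((chartAt E x₀).symm y))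
    ((contMDiffAt_chart_symm hy).mdifferentiableAt (by simp))
  have h2 := modelDeriv_comp (E := E) (E' := W × E) (E'' := E) (x := y)
    (g := fun y ↦ (w, y)) (f := orbitChart E σ x₀)
    ((contMDiffAt_orbitChart hO hσ hw hy).mdifferentiableAt (by simp))
    (hasFDerivAt_prodMk_right w y).differentiableAt.mdifferentiableAt
  rw [modelDeriv_eq_of_hasFDerivAt (hasFDerivAt_prodMk_right w y)] at h2
  exact h1.symm.trans h2

theorem modelDeriv_orbitChart_inl (hO : IsOpen O) (hσ : ContMDiffOn 𝓘(ℝ, W) 𝓘(ℝ, F) ∞ σ O)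
    (hw : w ∈ O) (hy : y ∈ (chartAt E x₀).target) (ξ : W) :
    modelDeriv (E := W) (E' := E) (fun w ↦ σ w • (chartAt E x₀).symm y) w ξ =
    modelDeriv (E := W × E) (E' := E) (orbitChart E σ x₀) (w, y) (ξ, 0) := by
  have h2 := modelDeriv_comp (E := W) (E' := W × E) (E'' := E) (x := w)
    (g := fun w ↦ (w, y)) (f := orbitChart E σ x₀)
    ((contMDiffAt_orbitChart hO hσ hw hy).mdifferentiableAt (by simp))
    (hasFDerivAt_prodMk_left w y).differentiableAt.mdifferentiableAt
  rw [modelDeriv_eq_of_hasFDerivAt (hasFDerivAt_prodMk_left w y)] at h2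
  exact congrArg (fun L : W →L[ℝ] E ↦ L ξ) h2

/-- All translates are slices of the single form Φ^*α on `W × E`, Φ being `orbitChart`. Joint
smoothness and parameter derivatives are thus questions about one form on a vector space. -/
theorem inChart_pullback_smul (hO : IsOpen O) (hσ : ContMDiffOn 𝓘(ℝ, W) 𝓘(ℝ, F) ∞ σ O)
    (hw : w ∈ O) (hy : y ∈ (chartAt E x₀).target) (α : RawForm E M k) :
    inChart x₀ (pullback (fun x : M ↦ σ w • x) α) y =
      ((pullback (E := W × E) (orbitChart E σ x₀) α).at (w, y)).compContinuousLinearMap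
        (ContinuousLinearMap.inr ℝ W E) :=
  congrArg (fun L : E →L[ℝ] E ↦
    (α.at (orbitChart E σ x₀ (w, y))).compContinuousLinearMap L)
    (modelDeriv_orbitChart_inr hO hσ hw hy)

theorem inChart_contractPullback (hO : IsOpen O) (hσ : ContMDiffOn 𝓘(ℝ, W) 𝓘(ℝ, F) ∞ σ O)
    (hw : w ∈ O) (hy : y ∈ (chartAt E x₀).target) (ξ : W) (α : RawForm E M (k + 1)) :
    inChart x₀ (contractPullback σ w ξ α) y =
      (((pullback (E := W × E) (orbitChart E σ x₀) α).at (w, y)).curryLeft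
          (ξ, 0)).compContinuousLinearMap (ContinuousLinearMap.inr ℝ W E) := by
  rw [pullback_at, ContinuousAlternatingMap.curryLeft_compContinuousLinearMap,
    ← modelDeriv_orbitChart_inl hO hσ hw hy]
  exact congrArg (fun L : E →L[ℝ] E ↦ ((α.at (orbitChart E σ x₀ (w, y))).curryLeft
      (modelDeriv (E := W) (E' := E) (fun w ↦ σ w • (chartAt E x₀).symm y) w
        ξ)).compContinuousLinearMap L) (modelDeriv_orbitChart_inr hO hσ hw hy)

variable [FiniteDimensional ℝ E] [FiniteDimensional ℝ W]

theorem isSmoothFamily_pullback_smul (hO : IsOpen O)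
    (hσ : ContMDiffOn 𝓘(ℝ, W) 𝓘(ℝ, F) ∞ σ O) {α : RawForm E M k} (hα : IsSmooth α) :
    IsSmoothFamily O (fun w ↦ pullback (E := E) (fun x : M ↦ σ w • x) α) := by
  intro x₀
  refine ContDiffOn.congr (f := fun z : W × E ↦
    ContinuousAlternatingMap.compContinuousLinearMapCLM (F := ℝ) (ι := Fin k)
      (ContinuousLinearMap.inr ℝ W E) ((pullback (E := W × E) (orbitChart E σ x₀) α).at z)) ?_
    fun z hz ↦ inChart_pullback_smul hO hσ hz.1 hz.2 α
  exact (ContinuousLinearMap.contDiff _).comp_contDiffOn fun z hz ↦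
    (hα.contDiffAt_pullback (contMDiffAt_orbitChart hO hσ hz.1 hz.2)).contDiffWithinAt

/-- Contraction with a vector and restriction to the slices, as a linear map. -/
def contractSlice (E : Type*) [NormedAddCommGroup E] [NormedSpace ℝ E] {W : Type*}
    [NormedAddCommGroup W] [NormedSpace ℝ W] (k : ℕ) (ξ : W) :
    ((W × E) [⋀^Fin (k + 1)]→L[ℝ] ℝ) →L[ℝ] (E [⋀^Fin k]→L[ℝ] ℝ) :=
  (ContinuousAlternatingMap.compContinuousLinearMapCLM (F := ℝ) (ι := Fin k)
    (ContinuousLinearMap.inr ℝ W E)).comp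
    ((ContinuousLinearMap.apply ℝ ((W × E) [⋀^Fin k]→L[ℝ] ℝ) ((ξ, 0) : W × E)).comp
      (ContinuousAlternatingMap.curryLeftLI (𝕜 := ℝ) (E := W × E) (F := ℝ)
        (n := k)).toContinuousLinearMap)

theorem isSmoothFamily_contractPullback (hO : IsOpen O)
    (hσ : ContMDiffOn 𝓘(ℝ, W) 𝓘(ℝ, F) ∞ σ O) (ξ : W) {α : RawForm E M (k + 1)} (hα : IsSmooth α) :
    IsSmoothFamily O (fun w ↦ contractPullback σ w ξ α) := by
  intro x₀
  refine ContDiffOn.congr (f := fun z : W × E ↦ contractSlice E k ξ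
      ((pullback (E := W × E) (orbitChart E σ x₀) α).at z)) ?_
    fun z hz ↦ inChart_contractPullback hO hσ hz.1 hz.2 ξ α
  exact (ContinuousLinearMap.contDiff _).comp_contDiffOn fun z hz ↦
    (hα.contDiffAt_pullback (contMDiffAt_orbitChart hO hσ hz.1 hz.2)).contDiffWithinAt

end Orbit

end DeRham

/-! ### Ingredients of the homotopy: integration over [0, 1] and degree 0. -/

section Homotopy

theorem prod_restrict_compl_eq_zero {V : Type*} [TopologicalSpace V] [T2Space V]
    [MeasurableSpace V] [OpensMeasurableSpace V] {ν : Measure V} [SFinite ν] {B : Set V}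
    (hB : IsCompact B) (hν : ν Bᶜ = 0) :
    ν.prod (volume.restrict (Icc (0 : ℝ) 1)) (B ×ˢ Icc (0 : ℝ) 1)ᶜ = 0 := by
  rw [← Measure.restrict_eq_self_of_ae_mem (mem_ae_iff.2 hν), Measure.prod_restrict,
    Measure.restrict_apply' (hB.measurableSet.prod measurableSet_Icc)]
  simp

/-- The fundamental theorem of calculus, integrated over a parameter. -/
theorem ContDiffOn.integral_fderiv_prod {V X : Type*} [NormedAddCommGroup V] [NormedSpace ℝ V]
    [SecondCountableTopology V] [MeasurableSpace V] [BorelSpace V] [NormedAddCommGroup X]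
    [NormedSpace ℝ X] [CompleteSpace X] {ν : Measure V} [IsFiniteMeasure ν] {f : V × ℝ → X}
    {B : Set V} {O : Set (V × ℝ)} (hf : ContDiffOn ℝ ∞ f O) (hO : IsOpen O) (hB : IsCompact B)
    (hBO : B ×ˢ Icc (0 : ℝ) 1 ⊆ O) (hν : ν Bᶜ = 0) :
    ∫ w, fderiv ℝ f w (0, 1) ∂(ν.prod (volume.restrict (Icc (0 : ℝ) 1))) =
      ∫ v, (f (v, 1) - f (v, 0)) ∂ν := by
  have hc : ContinuousOn (fun w ↦ fderiv ℝ f w (0, 1)) (B ×ˢ Icc (0 : ℝ) 1) :=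
    ((hf.fderiv_of_isOpen (m := ∞) hO (by simp)).continuousOn.clm_apply continuousOn_const).mono hBO
  rw [integral_prod]
  · refine integral_congr_ae ?_
    filter_upwards [mem_ae_iff.2 hν] with v hv
    have hd : ∀ t ∈ uIcc (0 : ℝ) 1, HasDerivAt (fun t ↦ f (v, t)) (fderiv ℝ f (v, t) (0, 1)) t := by
      intro t ht
      rw [uIcc_of_le zero_le_one] at ht
      have h1 : HasFDerivAt f (fderiv ℝ f (v, t)) (v, t) :=
        ((hf.contDiffAt (hO.mem_nhds (hBO ⟨hv, ht⟩))).differentiableAt (by simp)).hasFDerivAt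
      exact h1.comp_hasDerivAt t ((hasDerivAt_const t v).prodMk (hasDerivAt_id t))
    have hi : IntervalIntegrable (fun t ↦ fderiv ℝ f (v, t) (0, 1)) volume 0 1 := by
      refine ContinuousOn.intervalIntegrable ?_
      rw [uIcc_of_le zero_le_one]
      exact hc.comp (by fun_prop) fun t ht ↦ ⟨hv, ht⟩
    rw [integral_Icc_eq_integral_Ioc, ← intervalIntegral.integral_of_le zero_le_one,
      intervalIntegral.integral_eq_sub_of_hasDerivAt hd hi]
  · exact hc.integrable_of_measure_compl_eq_zero (hB.prod isCompact_Icc)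
      (prod_restrict_compl_eq_zero hB hν)

/-- In degree 0 the exterior derivative is the differential itself. This replaces Cartan's formula
there, as no contraction is available. -/
theorem fderiv_eq_zero_of_extDeriv_eq_zero {E : Type*} [NormedAddCommGroup E] [NormedSpace ℝ E]
    {η : E → E [⋀^Fin 0]→L[ℝ] ℝ} {x : E} (h : extDeriv η x = 0) : fderiv ℝ η x = 0 := by
  ext Z v
  have h1 := congrArg (fun A : E [⋀^Fin 1]→L[ℝ] ℝ ↦ A fun _ ↦ Z) h
  rw [extDeriv] at h1
  simpa [ContinuousAlternatingMap.alternatizeUncurryFin_apply, Subsingleton.elim _ v] using h1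

end Homotopy

namespace DeRham

/-! ### The homotopy formula for translates of closed forms. -/

section Closed

variable {F : Type*} [NormedAddCommGroup F] [NormedSpace ℝ F]
  {T : Type*} [Group T] [TopologicalSpace T] [ChartedSpace F T]
  {E : Type*} [NormedAddCommGroup E] [NormedSpace ℝ E]
  {M : Type*} [TopologicalSpace M] [ChartedSpace E M] [IsManifold 𝓘(ℝ, E) ∞ M]
  [MulAction T M] [ContMDiffSMul 𝓘(ℝ, F) 𝓘(ℝ, E) ∞ T M]
  {W : Type*} [NormedAddCommGroup W] [NormedSpace ℝ W] {k : ℕ} {σ : W → T} {O : Set W}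
  {w : W}

theorem extDeriv_pullback_orbitChart (hO : IsOpen O) (hσ : ContMDiffOn 𝓘(ℝ, W) 𝓘(ℝ, F) ∞ σ O)
    (hw : w ∈ O) {α : RawForm E M k} (hα : IsSmooth α) (hd : rawD α = 0) (x : M) :
    extDeriv (pullback (E := W × E) (orbitChart E σ x) α).at (w, chartAt E x x) = 0 := by
  refine (extDeriv_pullback_eq hα
    (contMDiffAt_orbitChart hO hσ hw (mem_chart_target E x))).trans ?_
  rw [hd]
  rfl

variable [FiniteDimensional ℝ E] [FiniteDimensional ℝ W]

/-- In the chart at `x` the translate is a fixed linear map applied to Φ^*α at `(w, chartAt E x x)`.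
Its parameter derivative is therefore governed by the derivative of Φ^*α along `(ξ, 0)`, the
right-hand side of Cartan's formula. -/
theorem fderiv_pullback_smul_at (hO : IsOpen O) (hσ : ContMDiffOn 𝓘(ℝ, W) 𝓘(ℝ, F) ∞ σ O)
    (hw : w ∈ O) {α : RawForm E M k} (hα : IsSmooth α) (x : M) (ξ : W) :
    fderiv ℝ (fun w ↦ (pullback (E := E) (fun x : M ↦ σ w • x) α).at x) w ξ =
      ((fderiv ℝ (pullback (E := W × E) (orbitChart E σ x) α).at (w, chartAt E x x)
        (ξ, 0)).compContinuousLinearMap (ContinuousLinearMap.inr ℝ W E)).compContinuousLinearMap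
        (modelDeriv (E := E) (E' := E) (chartAt E x) x) := by
  have hx := mem_chart_source E x
  have hy := mem_chart_target E x
  let A : ((W × E) [⋀^Fin k]→L[ℝ] ℝ) →L[ℝ] (E [⋀^Fin k]→L[ℝ] ℝ) :=
    (ContinuousAlternatingMap.compContinuousLinearMapCLM (F := ℝ) (ι := Fin k)
      (modelDeriv (E := E) (E' := E) (chartAt E x) x)).comp
    (ContinuousAlternatingMap.compContinuousLinearMapCLM (F := ℝ) (ι := Fin k)
      (ContinuousLinearMap.inr ℝ W E))
  have h1 : (fun w ↦ (pullback (E := E) (fun x : M ↦ σ w • x) α).at x) =ᶠ[𝓝 w]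
      fun w ↦ A ((pullback (E := W × E) (orbitChart E σ x) α).at (w, chartAt E x x)) := by
    filter_upwards [hO.mem_nhds hw] with v hv
    rw [at_eq_inChart _ hx, inChart_pullback_smul hO hσ hv hy]
    rfl
  have h2 : HasFDerivAt (pullback (E := W × E) (orbitChart E σ x) α).at _ (w, chartAt E x x) :=
    ((hα.contDiffAt_pullback (contMDiffAt_orbitChart hO hσ hw hy)).differentiableAt
      (by simp)).hasFDerivAt
  have h3 := A.hasFDerivAt.comp w (h2.comp w (hasFDerivAt_prodMk_left w (chartAt E x x)))
  rw [h1.fderiv_eq]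
  exact congrArg (fun L : W →L[ℝ] (E [⋀^Fin k]→L[ℝ] ℝ) ↦ L ξ) h3.fderiv

/-- Cartan's homotopy formula for closed forms and families of translations. -/
theorem rawD_contractPullback (hO : IsOpen O) (hσ : ContMDiffOn 𝓘(ℝ, W) 𝓘(ℝ, F) ∞ σ O)
    (hw : w ∈ O) {α : RawForm E M (k + 1)} (hα : IsSmooth α) (hd : rawD α = 0) (x : M) (ξ : W) :
    (rawD (contractPullback σ w ξ α)).at x =
      fderiv ℝ (fun w ↦ (pullback (E := E) (fun x : M ↦ σ w • x) α).at x) w ξ := by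
  have hy := mem_chart_target E x
  have h2 : DifferentiableAt ℝ (pullback (E := W × E) (orbitChart E σ x) α).at
      (w, chartAt E x x) :=
    (hα.contDiffAt_pullback (contMDiffAt_orbitChart hO hσ hw hy)).differentiableAt (by simp)
  -- Φ^*α is closed, so Cartan's formula keeps only d(ι Φ^*α).
  have hC := extDeriv_curryLeft_add h2 (ξ, 0)
  rw [extDeriv_pullback_orbitChart hO hσ hw hα hd x, ContinuousAlternatingMap.curryLeft_zero,
    _root_.zero_apply, add_zero] at hC
  -- Restriction to the slice is written as pullback by `y ↦ (w, y)`, so that it commutes with d.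
  have h1 : inChart x (contractPullback σ w ξ α) =ᶠ[𝓝 (chartAt E x x)] fun y ↦
      (((pullback (E := W × E) (orbitChart E σ x) α).at (w, y)).curryLeft
        (ξ, 0)).compContinuousLinearMap (fderiv ℝ (fun y : E ↦ (w, y)) y) := by
    filter_upwards [(chartAt E x).open_target.mem_nhds hy] with y hy
    rw [(hasFDerivAt_prodMk_right w y).fderiv]
    exact inChart_contractPullback hO hσ hw hy ξ α
  have h3 : DifferentiableAt ℝ (fun z ↦ ((pullback (E := W × E) (orbitChart E σ x) α).at
      z).curryLeft (ξ, 0)) (w, chartAt E x x) :=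
    (((ContinuousLinearMap.apply ℝ ((W × E) [⋀^Fin k]→L[ℝ] ℝ) ((ξ, 0) : W × E)).comp
      (ContinuousAlternatingMap.curryLeftLI (𝕜 := ℝ) (E := W × E) (F := ℝ)
        (n := k)).toContinuousLinearMap)).differentiableAt.comp _ h2
  have h4 := extDeriv_pullback (r := ∞) (f := fun y : E ↦ (w, y)) h3 (by fun_prop)
    (by rw [minSmoothness_of_isRCLikeNormedField]; exact ENat.LEInfty.out)
  rw [fderiv_pullback_smul_at hO hσ hw hα, ← hC, rawD_at, h1.extDeriv_eq, h4,
    (hasFDerivAt_prodMk_right w _).fderiv]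

theorem fderiv_pullback_smul_at_eq_zero (hO : IsOpen O)
    (hσ : ContMDiffOn 𝓘(ℝ, W) 𝓘(ℝ, F) ∞ σ O) (hw : w ∈ O) {α : RawForm E M 0} (hα : IsSmooth α)
    (hd : rawD α = 0) (x : M) (ξ : W) :
    fderiv ℝ (fun w ↦ (pullback (E := E) (fun x : M ↦ σ w • x) α).at x) w ξ = 0 := by
  rw [fderiv_pullback_smul_at hO hσ hw hα,
    fderiv_eq_zero_of_extDeriv_eq_zero (extDeriv_pullback_orbitChart hO hσ hw hα hd x)]
  rfl

end Closed

/-! ### Exact forms and averages supported in a ball. -/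

section Exact

variable {E : Type*} [NormedAddCommGroup E] [NormedSpace ℝ E]
  {M : Type*} [TopologicalSpace M] [ChartedSpace E M] [IsManifold 𝓘(ℝ, E) ∞ M] {k : ℕ}

variable (E M) in
/-- The exact forms, as a subspace of the space of all forms. -/
def exactForms (k : ℕ) : Submodule ℝ (RawForm E M k) :=
  (coboundaries (A := fun k ↦ Form E M k) d k).map (Form E M k).subtype

theorem rawD_mem_exactForms {β : RawForm E M k} (hβ : IsSmooth β) :
    rawD β ∈ exactForms E M (k + 1) :=
  ⟨d k ⟨β, hβ⟩, ⟨⟨β, hβ⟩, rfl⟩, rfl⟩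

theorem mem_coboundaries_of_mem_exactForms {α : Form E M k} (h : α.1 ∈ exactForms E M k) :
    α ∈ coboundaries (A := fun k ↦ Form E M k) d k := by
  obtain ⟨β, hβ, h⟩ := h
  rwa [← Subtype.ext h]

end Exact

section Translates

variable {F : Type*} [NormedAddCommGroup F] [NormedSpace ℝ F]
  {T : Type*} [Group T] [TopologicalSpace T] [ChartedSpace F T]
  {E : Type*} [NormedAddCommGroup E] [NormedSpace ℝ E]
  {M : Type*} [TopologicalSpace M] [ChartedSpace E M]
  [MulAction T M] {k : ℕ}

/-- The pullback of a form by the action of a group element. -/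
def translate (α : RawForm E M k) (g : T) : RawForm E M k := pullback (fun x : M ↦ g • x) α

variable [IsManifold 𝓘(ℝ, E) ∞ M] [ContMDiffSMul 𝓘(ℝ, F) 𝓘(ℝ, E) ∞ T M]
  {V : Type*} [NormedAddCommGroup V] [NormedSpace ℝ V] {ψ : V → T} {O : Set V}
  [FiniteDimensional ℝ E] [FiniteDimensional ℝ V]

/-- An average of translates of a closed form by elements of a ball is cohomologous to a multiple
of the translate by the centre of the ball. -/
theorem integralForm_translate_sub_mem_exactForms [MeasurableSpace V] [BorelSpace V]
    {ν : Measure V} [IsFiniteMeasure ν] {p : V} {r : ℝ} (hr : 0 ≤ r) (hO : IsOpen O)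
    (hψ : ContMDiffOn 𝓘(ℝ, V) 𝓘(ℝ, F) ∞ ψ O) (hB : Metric.closedBall p r ⊆ O)
    (hν : ν (Metric.closedBall p r)ᶜ = 0) {α : RawForm E M k} (hα : IsSmooth α)
    (hd : rawD α = 0) :
    integralForm ν (fun v ↦ translate α (ψ v)) - ν.real univ • translate α (ψ p) ∈
      exactForms E M k := by
  have : ProperSpace V := FiniteDimensional.proper_real V
  set B := Metric.closedBall p r with hBdef
  have hBc : IsCompact B := isCompact_closedBall p r
  -- The linear contraction of the ball, constant `p` at time 0 and the identity at time 1.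
  let c : V × ℝ → V := fun z ↦ p + z.2 • (z.1 - p)
  have hc : ContDiff ℝ ∞ c := by fun_prop
  have hO' : IsOpen (c ⁻¹' O) := hO.preimage hc.continuous
  have hσ : ContMDiffOn 𝓘(ℝ, V × ℝ) 𝓘(ℝ, F) ∞ (ψ ∘ c) (c ⁻¹' O) :=
    hψ.comp hc.contMDiff.contMDiffOn fun _ h ↦ h
  have hK : B ×ˢ Icc (0 : ℝ) 1 ⊆ c ⁻¹' O := fun z hz ↦
    hB ((convex_closedBall p r).add_smul_sub_mem (Metric.mem_closedBall_self hr) hz.1 hz.2)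
  have hKc : IsCompact (B ×ˢ Icc (0 : ℝ) 1) := hBc.prod isCompact_Icc
  have hν' := prod_restrict_compl_eq_zero hBc hν
  have hsm := isSmoothFamily_pullback_smul (M := M) (E := E) hO' hσ hα
  have hint : ∀ x, Integrable (fun v ↦ (translate α (ψ v)).at x) ν := fun x ↦
    (isSmoothFamily_pullback_smul (M := M) (E := E) hO hψ hα).integrable hBc hB hν x
  -- The fundamental theorem of calculus along each segment; the constant endpoint `p` contributes
  -- the total mass of `ν`.
  have hmain : integralForm ν (fun v ↦ translate α (ψ v)) - ν.real univ • translate α (ψ p) =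
      RawForm.ofModel fun x ↦ ∫ w, fderiv ℝ (fun w ↦ (translate α ((ψ ∘ c) w)).at x) w (0, 1)
        ∂(ν.prod (volume.restrict (Icc (0 : ℝ) 1))) := by
    refine RawForm.ext_at fun x ↦ ?_
    refine Eq.trans ?_ ((hsm.contDiffOn_apply x).integral_fderiv_prod hO' hBc hK hν).symm
    have h1 : ∀ v, c (v, 1) = v := fun v ↦ by simp [c]
    have h0 : ∀ v, c (v, 0) = p := fun v ↦ by simp [c]
    simp only [Function.comp, h1, h0]
    refine Eq.trans ?_ (integral_sub (hint x) (integrable_const _)).symm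
    rw [integral_const]
    rfl
  rw [hmain]
  cases k with
  | zero =>
    convert zero_mem (exactForms E M 0)
    refine RawForm.ext_at fun x ↦ ?_
    refine integral_eq_zero_of_ae ?_
    filter_upwards [mem_ae_iff.2 hν'] with w hw
    exact fderiv_pullback_smul_at_eq_zero hO' hσ (hK hw) hα hd x _
  | succ k =>
    -- The primitive is the integral over V × [0, 1] of the contraction with the time direction `(0,
    -- 1)`.
    have hC := isSmoothFamily_contractPullback (M := M) (E := E) hO' hσ ((0, 1) : V × ℝ) hα
    convert rawD_mem_exactForms (hC.isSmooth_integralForm hO' hKc hK hν')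
    rw [hC.rawD_integralForm hO' hKc hK hν']
    refine RawForm.ext_at fun x ↦ integral_congr_ae ?_
    filter_upwards [mem_ae_iff.2 hν'] with w hw
    exact (rawD_contractPullback hO' hσ (hK hw) hα hd x _).symm

end Translates

/-! ### Averages over measures carried by a small open set of the group. -/

section Average

variable {T : Type*} [Group T] [TopologicalSpace T]
  {E : Type*} [NormedAddCommGroup E] [NormedSpace ℝ E] [FiniteDimensional ℝ E]
  {M : Type*} [TopologicalSpace M] [ChartedSpace E M] [IsManifold 𝓘(ℝ, E) ∞ M]
  [MulAction T M] {k : ℕ}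

theorem continuous_translate_at (F : Type*) [NormedAddCommGroup F] [NormedSpace ℝ F]
    [FiniteDimensional ℝ F] [ChartedSpace F T] [IsManifold 𝓘(ℝ, F) ∞ T]
    [ContMDiffSMul 𝓘(ℝ, F) 𝓘(ℝ, E) ∞ T M] {α : RawForm E M k} (hα : IsSmooth α) (x : M) :
    Continuous fun g : T ↦ (translate α g).at x := by
  refine continuous_iff_continuousAt.2 fun g ↦ ?_
  have h := (isSmoothFamily_pullback_smul (M := M) (E := E) (chartAt F g).open_target
    contMDiffOn_chart_symm hα).contDiffOn_apply x
  have hg := mem_chart_target F g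
  have h1 := (h.continuousOn.continuousAt ((chartAt F g).open_target.mem_nhds hg)).comp
    ((chartAt F g).continuousAt (mem_chart_source F g))
  refine h1.congr ?_
  filter_upwards [(chartAt F g).open_source.mem_nhds (mem_chart_source F g)] with g' hg'
  simp only [Function.comp, translate, (chartAt F g).left_inv hg']

/-- The good properties of an average of translates with respect to a measure. -/
structure IsGoodAverage (E M : Type*) [NormedAddCommGroup E] [NormedSpace ℝ E]
    [TopologicalSpace M] [ChartedSpace E M] [IsManifold 𝓘(ℝ, E) ∞ M] {T : Type*} [Group T]
    [MulAction T M] [MeasurableSpace T] (μ : Measure T) (g₀ : T) : Prop where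
  isSmooth {k : ℕ} {α : RawForm E M k} (hα : IsSmooth α) : IsSmooth (integralForm μ (translate α))
  rawD_eq {k : ℕ} {α : RawForm E M k} (hα : IsSmooth α) :
    rawD (integralForm μ (translate α)) = integralForm μ (translate (rawD α))
  sub_mem {k : ℕ} {α : RawForm E M k} (hα : IsSmooth α) (hd : rawD α = 0) :
    integralForm μ (translate α) - μ.real univ • translate α g₀ ∈ exactForms E M k

variable (E M) in
-- Pushing `μ` forward by the chart at `g₀` gives a measure on a closed ball of the model space,
-- where the results on smooth families apply.
theorem exists_nhds_isGoodAverage (F : Type*) [NormedAddCommGroup F] [NormedSpace ℝ F]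
    [FiniteDimensional ℝ F] [ChartedSpace F T] [IsManifold 𝓘(ℝ, F) ∞ T]
    [ContMDiffSMul 𝓘(ℝ, F) 𝓘(ℝ, E) ∞ T M] [MeasurableSpace T] [BorelSpace T] (g₀ : T) :
    ∃ U : Set T, IsOpen U ∧ g₀ ∈ U ∧ ∀ (μ : Measure T) [IsFiniteMeasure μ], μ Uᶜ = 0 →
      IsGoodAverage E M μ g₀ := by
  borelize F
  have : ProperSpace F := FiniteDimensional.proper_real F
  set e := chartAt F g₀ with he
  set p := e g₀ with hp
  have hg₀ : g₀ ∈ e.source := mem_chart_source F g₀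
  obtain ⟨r, hr, hB⟩ := Metric.nhds_basis_closedBall.mem_iff.1
    (e.open_target.mem_nhds (e.map_source hg₀))
  have hU : IsOpen (e.source ∩ e ⁻¹' Metric.ball p r) := e.isOpen_inter_preimage Metric.isOpen_ball
  refine ⟨e.source ∩ e ⁻¹' Metric.ball p r, hU, ⟨hg₀, Metric.mem_ball_self hr⟩, fun μ _ hμ ↦ ?_⟩
  have hae : ∀ᵐ g ∂μ, g ∈ e.source ∩ e ⁻¹' Metric.ball p r := mem_ae_iff.2 hμ
  -- The chart is controlled only on its source, hence measurability almost everywhere.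
  have hem : AEMeasurable e μ := by
    have h1 : ContinuousOn e (e.source ∩ e ⁻¹' Metric.ball p r) :=
      e.continuousOn.mono inter_subset_left
    have h2 := h1.aemeasurable (μ := μ) hU.measurableSet
    rwa [Measure.restrict_eq_self_of_ae_mem hae] at h2
  have hν : μ.map e (Metric.closedBall p r)ᶜ = 0 := by
    rw [Measure.map_apply_of_aemeasurable hem Metric.isClosed_closedBall.measurableSet.compl]
    exact measure_mono_null (fun g hg (h : g ∈ e.source ∩ e ⁻¹' Metric.ball p r) ↦
      hg (Metric.ball_subset_closedBall h.2)) hμ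
  have hψ : ContMDiffOn 𝓘(ℝ, F) 𝓘(ℝ, F) ∞ e.symm e.target := contMDiffOn_chart_symm
  have hBc := isCompact_closedBall p r
  have hmap {k : ℕ} {α : RawForm E M k} (hα : IsSmooth α) : integralForm μ (translate α) =
      integralForm (μ.map e) (fun v ↦ translate α (e.symm v)) := by
    refine RawForm.ext_at fun x ↦ ?_
    have hi := (isSmoothFamily_pullback_smul (M := M) (E := E) e.open_target hψ
      hα).integrable hBc hB hν x
    refine Eq.trans ?_ (integral_map hem hi.1).symm
    refine integral_congr_ae ?_
    filter_upwards [hae] with g hg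
    exact congrArg (fun g ↦ (translate α g).at x) (e.left_inv hg.1).symm
  have hsm {k : ℕ} {α : RawForm E M k} (hα : IsSmooth α) :
      IsSmoothFamily e.target (fun v ↦ translate α (e.symm v)) :=
    isSmoothFamily_pullback_smul (M := M) (E := E) e.open_target hψ hα
  refine ⟨fun hα ↦ ?_, fun hα ↦ ?_, fun {k α} hα hd ↦ ?_⟩
  · rw [hmap hα]
    exact (hsm hα).isSmooth_integralForm e.open_target hBc hB hν
  · rw [hmap hα, hmap hα.rawD, (hsm hα).rawD_integralForm e.open_target hBc hB hν]
    congr 1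
    funext v
    exact rawD_pullback hα (ContMDiffSMul.contMDiff_const_smul (I := 𝓘(ℝ, F))
      (I' := 𝓘(ℝ, E)) (n := ∞) (M := M) (e.symm v))
  · have h := integralForm_translate_sub_mem_exactForms (E := E) (M := M) hr.le e.open_target hψ
      hB hν hα hd
    have h2 : (μ.map e).real univ = μ.real univ := by
      rw [Measure.real, Measure.map_apply_of_aemeasurable hem MeasurableSet.univ, preimage_univ,
        Measure.real]
    rwa [h2, ← hmap hα, e.left_inv hg₀] at h

end Average

end DeRham

/-- Right invariance is what averaging needs, since s^*(g^*α) = (gs)^*α; inverting a left Haar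
measure provides it. The measure of `H` is pushed forward to `T`, so no smooth structure on `H`
enters. -/
theorem exists_isProbabilityMeasure_map_mul_right_eq {T : Type*} [Group T] [TopologicalSpace T]
    [IsTopologicalGroup T] [CompactSpace T] [MeasurableSpace T] [BorelSpace T] (H : Subgroup T)
    (hH : IsClosed (H : Set T)) :
    ∃ μ : Measure T, IsProbabilityMeasure μ ∧ μ (H : Set T)ᶜ = 0 ∧
      ∀ s ∈ H, μ.map (· * s) = μ := by
  have : CompactSpace H := isCompact_iff_compactSpace.1 hH.isCompact
  let μH : Measure H := (Measure.haarMeasure (⊤ : TopologicalSpace.PositiveCompacts H)).inv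
  have hμH : IsProbabilityMeasure μH := ⟨by
    rw [Measure.inv_apply, inv_univ, ← TopologicalSpace.PositiveCompacts.coe_top]
    exact Measure.haarMeasure_self⟩
  have hm : Measurable (Subtype.val : H → T) := measurable_subtype_coe
  refine ⟨μH.map Subtype.val, Measure.isProbabilityMeasure_map hm.aemeasurable, ?_, fun s hs ↦ ?_⟩
  · rw [Measure.map_apply hm hH.measurableSet.compl]
    convert measure_empty (μ := μH)
    ext x
    simp
  · conv_rhs => rw [← Measure.IsMulRightInvariant.map_mul_right_eq_self (μ := μH) ⟨s, hs⟩]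
    rw [Measure.map_map (measurable_mul_const s) hm,
      Measure.map_map hm (measurable_mul_const (⟨s, hs⟩ : H))]
    rfl

namespace DeRham

/-! ### From local to global: invariance, connectedness and compactness. -/

section Global

variable {T : Type*} [Group T] {E : Type*} [NormedAddCommGroup E] [NormedSpace ℝ E]
  {M : Type*} [TopologicalSpace M] [ChartedSpace E M] [MulAction T M] {k : ℕ}

theorem translate_one (α : RawForm E M k) : translate α (1 : T) = α := by
  have h : (fun x : M ↦ (1 : T) • x) = id := funext fun x ↦ one_smul T x
  rw [translate, h]
  funext x
  rw [pullback, mfderiv_id]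
  rfl

theorem integralForm_translate_eq_self [MeasurableSpace T] {μ : Measure T}
    [IsProbabilityMeasure μ] {α : RawForm E M k}
    (h : ∀ᵐ g ∂μ, translate α g = α) : integralForm μ (translate α) = α := by
  refine RawForm.ext_at fun x ↦ ?_
  have h1 : ∫ g, (translate α g).at x ∂μ = ∫ _, α.at x ∂μ := by
    refine integral_congr_ae ?_
    filter_upwards [h] with g hg
    rw [hg]
  exact h1.trans (by simp)

variable [TopologicalSpace T]

theorem pullback_smul_translate (F : Type*) [NormedAddCommGroup F] [NormedSpace ℝ F]
    [ChartedSpace F T] [ContMDiffSMul 𝓘(ℝ, F) 𝓘(ℝ, E) ∞ T M] (α : RawForm E M k) (g s : T) :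
    pullback (E := E) (fun x : M ↦ s • x) (translate α g) = translate α (g * s) := by
  have h : (fun x : M ↦ (g * s) • x) = (fun x : M ↦ g • x) ∘ (fun x : M ↦ s • x) :=
    funext fun x ↦ mul_smul g s x
  refine funext fun x ↦ ?_
  unfold translate
  rw [h, pullback_comp_apply (E' := E) (mdifferentiableAt_const_smul F g (s • x))
    (mdifferentiableAt_const_smul F s x)]

variable [IsManifold 𝓘(ℝ, E) ∞ M]

theorem rawD_add {α β : RawForm E M k} (hα : IsSmooth α) (hβ : IsSmooth β) :
    rawD (α + β) = rawD α + rawD β :=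
  congrArg Subtype.val ((d k).map_add (⟨α, hα⟩ : Form E M k) ⟨β, hβ⟩)

variable [FiniteDimensional ℝ E]

/-- A smooth form that is invariant under a subgroup is invariant under its closure. -/
theorem translate_eq_of_mem_closure (F : Type*) [NormedAddCommGroup F] [NormedSpace ℝ F]
    [FiniteDimensional ℝ F] [ChartedSpace F T] [IsManifold 𝓘(ℝ, F) ∞ T]
    [ContMDiffSMul 𝓘(ℝ, F) 𝓘(ℝ, E) ∞ T M] {S : Set T} {α : RawForm E M k} (hα : IsSmooth α)
    (h : ∀ s ∈ S, translate α s = α) {g : T} (hg : g ∈ closure S) : translate α g = α := by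
  refine RawForm.ext_at fun x ↦ ?_
  have hc : IsClosed {g : T | (translate α g).at x = α.at x} :=
    isClosed_eq (continuous_translate_at F hα x) continuous_const
  exact closure_minimal (fun s hs ↦ by simp [h s hs]) hc hg

variable [CompactSpace T] [MeasurableSpace T] [BorelSpace T]

theorem integrable_translate_at (F : Type*) [NormedAddCommGroup F] [NormedSpace ℝ F]
    [FiniteDimensional ℝ F] [ChartedSpace F T] [IsManifold 𝓘(ℝ, F) ∞ T]
    [ContMDiffSMul 𝓘(ℝ, F) 𝓘(ℝ, E) ∞ T M] (μ : Measure T) [IsFiniteMeasure μ] {α : RawForm E M k}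
    (hα : IsSmooth α) (x : M) : Integrable (fun g : T ↦ (translate α g).at x) μ := by
  have : ProperSpace F := FiniteDimensional.proper_real F
  have : SecondCountableTopology T := ChartedSpace.secondCountable_of_sigmaCompact F T
  exact (continuous_translate_at F hα x).integrable_of_hasCompactSupport
    (HasCompactSupport.of_compactSpace _)

theorem integralForm_add_measure (F : Type*) [NormedAddCommGroup F] [NormedSpace ℝ F]
    [FiniteDimensional ℝ F] [ChartedSpace F T] [IsManifold 𝓘(ℝ, F) ∞ T]
    [ContMDiffSMul 𝓘(ℝ, F) 𝓘(ℝ, E) ∞ T M] (μ ν : Measure T) [IsFiniteMeasure μ] [IsFiniteMeasure ν]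
    {α : RawForm E M k} (hα : IsSmooth α) :
    integralForm (μ + ν) (translate α) =
      integralForm μ (translate α) + integralForm ν (translate α) :=
  RawForm.ext_at fun x ↦ integral_add_measure (integrable_translate_at F μ hα x)
    (integrable_translate_at F ν hα x)

/-- Translates of a closed form by elements of a connected group are cohomologous. -/
theorem translate_sub_mem_exactForms (F : Type*) [NormedAddCommGroup F] [NormedSpace ℝ F]
    [FiniteDimensional ℝ F] [ChartedSpace F T] [IsManifold 𝓘(ℝ, F) ∞ T]
    [ContMDiffSMul 𝓘(ℝ, F) 𝓘(ℝ, E) ∞ T M] [ConnectedSpace T] {α : RawForm E M k} (hα : IsSmooth α)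
    (hd : rawD α = 0) (g : T) : translate α g - α ∈ exactForms E M k := by
  have : ProperSpace F := FiniteDimensional.proper_real F
  have : SecondCountableTopology T := ChartedSpace.secondCountable_of_sigmaCompact F T
  have key : ∀ g₀ : T, ∃ U : Set T, IsOpen U ∧ g₀ ∈ U ∧ ∀ g ∈ U,
      translate α g - translate α g₀ ∈ exactForms E M k := by
    intro g₀
    obtain ⟨U, hU, hg₀, h⟩ := exists_nhds_isGoodAverage E M F g₀
    refine ⟨U, hU, hg₀, fun g hg ↦ ?_⟩
    -- For a Dirac mass the average is the translate itself and the total mass is 1.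
    have h1 := (h (Measure.dirac g) (by
      rw [Measure.dirac_apply' _ hU.measurableSet.compl]; simpa using hg)).sub_mem hα hd
    have h2 : integralForm (Measure.dirac g) (translate α) = translate α g :=
      RawForm.ext_at fun x ↦ integral_dirac' _ _ (continuous_translate_at F hα x).stronglyMeasurable
    simpa [h2] using h1
  -- By `key` the class of `translate α g` is locally constant in `g`.
  have hC : IsClopen {g : T | translate α g - α ∈ exactForms E M k} := by
    constructor
    · refine ⟨isOpen_iff_mem_nhds.2 fun g₀ hg₀ ↦ ?_⟩
      obtain ⟨U, hU, hgU, h⟩ := key g₀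
      filter_upwards [hU.mem_nhds hgU] with g hg hg'
      refine hg₀ ?_
      have := sub_mem (show translate α g - α ∈ exactForms E M k from hg') (h g hg)
      simpa using this
    · refine isOpen_iff_mem_nhds.2 fun g₀ hg₀ ↦ ?_
      obtain ⟨U, hU, hgU, h⟩ := key g₀
      filter_upwards [hU.mem_nhds hgU] with g hg
      have := add_mem (h g hg) (show translate α g₀ - α ∈ exactForms E M k from hg₀)
      simpa using this
  have h1 := hC.eq_univ ⟨1, by simp [translate_one]⟩
  exact (Set.ext_iff.1 h1 g).2 (mem_univ g)

variable (E M) in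
-- The properties are additive in the measure, so compactness reduces them to small neighbourhoods.
-- Connectedness replaces each local centre by the common reference point 1, without which the
-- pieces could not be added.
theorem isGoodAverage (F : Type*) [NormedAddCommGroup F] [NormedSpace ℝ F]
    [FiniteDimensional ℝ F] [ChartedSpace F T] [IsManifold 𝓘(ℝ, F) ∞ T]
    [ContMDiffSMul 𝓘(ℝ, F) 𝓘(ℝ, E) ∞ T M] [ConnectedSpace T] (μ : Measure T) [IsFiniteMeasure μ] :
    IsGoodAverage E M μ 1 := by
  have key : ∃ s : Set T, MeasurableSet s ∧ univ ⊆ s ∧ ∀ (μ : Measure T) [IsFiniteMeasure μ],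
      μ sᶜ = 0 → IsGoodAverage E M μ 1 := by
    have hloc : ∀ g : T, ∃ s : Set T, IsOpen s ∧ g ∈ s ∧ ∀ (μ : Measure T) [IsFiniteMeasure μ],
        μ sᶜ = 0 → IsGoodAverage E M μ 1 := by
      intro g
      obtain ⟨U, hU, hg, h⟩ := exists_nhds_isGoodAverage E M F g
      refine ⟨U, hU, hg, fun μ _ hμ ↦
        ⟨(h μ hμ).isSmooth, (h μ hμ).rawD_eq, fun {k α} hα hd ↦ ?_⟩⟩
      have h1 := add_mem ((h μ hμ).sub_mem hα hd) ((exactForms E M k).smul_mem (μ.real univ)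
        (translate_sub_mem_exactForms F hα hd g))
      rw [smul_sub, sub_add_sub_cancel] at h1
      rwa [translate_one]
    refine isCompact_univ.induction_on (p := fun t ↦ ∃ s : Set T, MeasurableSet s ∧ t ⊆ s ∧
      ∀ (μ : Measure T) [IsFiniteMeasure μ], μ sᶜ = 0 → IsGoodAverage E M μ 1) ?_ ?_ ?_ ?_
    · obtain ⟨s, hs, -, h⟩ := hloc 1
      exact ⟨s, hs.measurableSet, empty_subset _, h⟩
    · rintro t t' htt' ⟨s, hs, hts, h⟩
      exact ⟨s, hs, htt'.trans hts, h⟩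
    · rintro t t' ⟨s, hs, hts, h⟩ ⟨s', hs', hts', h'⟩
      refine ⟨s ∪ s', hs.union hs', union_subset_union hts hts', fun μ _ hμ ↦ ?_⟩
      have h1 := h (μ.restrict s) (by simp [Measure.restrict_apply hs.compl])
      -- Cutting along `s` avoids double counting on the overlap: the part off `s` is carried by
      -- `s'`.
      have h2 := h' (μ.restrict sᶜ) (by
        rw [Measure.restrict_apply hs'.compl, inter_comm, ← compl_union, hμ])
      rw [← Measure.restrict_add_restrict_compl (μ := μ) hs]
      refine ⟨fun hα ↦ ?_, fun hα ↦ ?_, fun {k α} hα hd ↦ ?_⟩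
      · rw [integralForm_add_measure F _ _ hα]
        exact (Form E M _).add_mem (h1.isSmooth hα) (h2.isSmooth hα)
      · rw [integralForm_add_measure F _ _ hα, integralForm_add_measure F _ _ hα.rawD,
          rawD_add (h1.isSmooth hα) (h2.isSmooth hα), h1.rawD_eq hα, h2.rawD_eq hα]
      · rw [integralForm_add_measure F _ _ hα, measureReal_add_apply, add_smul, add_sub_add_comm]
        exact add_mem (h1.sub_mem hα hd) (h2.sub_mem hα hd)
    · intro g _
      obtain ⟨s, hs, hg, h⟩ := hloc g
      exact ⟨s, mem_nhdsWithin_of_mem_nhds (hs.mem_nhds hg), s, hs.measurableSet, subset_rfl, h⟩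
  obtain ⟨s, -, hs, h⟩ := key
  refine h μ ?_
  rw [univ_subset_iff.1 hs, compl_univ, measure_empty]

/-- Pullback by `s` passes under the integral and turns `g` into `g * s`, a substitution that
preserves `μ`. -/
theorem pullback_integralForm_translate (F : Type*) [NormedAddCommGroup F] [NormedSpace ℝ F]
    [FiniteDimensional ℝ F] [ChartedSpace F T] [IsManifold 𝓘(ℝ, F) ∞ T]
    [ContMDiffSMul 𝓘(ℝ, F) 𝓘(ℝ, E) ∞ T M] {μ : Measure T} [IsFiniteMeasure μ] {s : T}
    [ContinuousMul T] (hs : μ.map (· * s) = μ) {α : RawForm E M k} (hα : IsSmooth α) :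
    pullback (E := E) (fun x : M ↦ s • x) (integralForm μ (translate α)) =
      integralForm μ (translate α) := by
  refine RawForm.ext_at fun x ↦ ?_
  have h1 := (ContinuousAlternatingMap.compContinuousLinearMapCLM (F := ℝ) (ι := Fin k)
    (modelDeriv (E := E) (E' := E) (fun x : M ↦ s • x) x)).integral_comp_comm
      (integrable_translate_at F μ hα (s • x))
  refine h1.symm.trans ?_
  have h2 : ∀ g : T, ContinuousAlternatingMap.compContinuousLinearMapCLM (F := ℝ) (ι := Fin k)
      (modelDeriv (E := E) (E' := E) (fun x : M ↦ s • x) x) ((translate α g).at (s • x)) =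
      (translate α (g * s)).at x := fun g ↦
    congrArg (fun β : RawForm E M k ↦ β.at x) (pullback_smul_translate F α g s)
  simp only [h2]
  have h3 := integral_map (μ := μ) (φ := (· * s)) (measurable_mul_const s).aemeasurable
    (f := fun g ↦ (translate α g).at x) (by
      rw [hs]; exact (integrable_translate_at F μ hα x).1)
  rw [hs] at h3
  exact h3.symm

end Global

/-! ### Criteria on cochains, and the comparison with de Rham cohomology. -/

section Algebra

variable {A : ℕ → Type*} [∀ k, AddCommGroup (A k)] [∀ k, Module ℝ (A k)]
  {B : ℕ → Type*} [∀ k, AddCommGroup (B k)] [∀ k, Module ℝ (B k)]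
  {δ : ∀ k, A k →ₗ[ℝ] A (k + 1)} {ε : ∀ k, B k →ₗ[ℝ] B (k + 1)}
  {φ : ∀ k, A k →ₗ[ℝ] B k} {h : ∀ k, ε k ∘ₗ φ k = φ (k + 1) ∘ₗ δ k} {k : ℕ}

theorem cohomologyMap_injective
    (hφ : ∀ a, δ k a = 0 → φ k a ∈ coboundaries ε k → a ∈ coboundaries δ k) :
    Function.Injective (cohomologyMap δ ε φ h k) := by
  rw [← LinearMap.ker_eq_bot, LinearMap.ker_eq_bot']
  intro q hq
  obtain ⟨⟨a, ha⟩, rfl⟩ := Submodule.Quotient.mk_surjective _ q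
  have hq' := (Submodule.Quotient.mk_eq_zero _).1 hq
  exact (Submodule.Quotient.mk_eq_zero _).2 (hφ a ha hq')

theorem cohomologyMap_surjective
    (hφ : ∀ b, ε k b = 0 → ∃ a, δ k a = 0 ∧ φ k a - b ∈ coboundaries ε k) :
    Function.Surjective (cohomologyMap δ ε φ h k) := by
  intro q
  obtain ⟨⟨b, hb⟩, rfl⟩ := Submodule.Quotient.mk_surjective _ q
  obtain ⟨a, ha, hab⟩ := hφ b hb
  exact ⟨Submodule.Quotient.mk ⟨a, ha⟩, (Submodule.Quotient.eq _).2 hab⟩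

end Algebra

theorem bijective_invCohomologyToDeRham
    (F : Type*) [NormedAddCommGroup F] [NormedSpace ℝ F] [FiniteDimensional ℝ F]
    {T : Type*} [Group T] [TopologicalSpace T] [ChartedSpace F T] [LieGroup 𝓘(ℝ, F) ∞ T]
    [CompactSpace T] [ConnectedSpace T]
    (E : Type*) [NormedAddCommGroup E] [NormedSpace ℝ E] [FiniteDimensional ℝ E]
    (M : Type*) [TopologicalSpace M] [ChartedSpace E M] [IsManifold 𝓘(ℝ, E) ∞ M]
    [MulAction T M] [ContMDiffSMul 𝓘(ℝ, F) 𝓘(ℝ, E) ∞ T M]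
    (S : Subgroup T) (k : ℕ) :
    Function.Bijective (invCohomologyToDeRham F E M S k) := by
  borelize T
  have : IsTopologicalGroup T := topologicalGroup_of_lieGroup 𝓘(ℝ, F) ∞
  -- The closure of `S` is compact and so carries an invariant probability measure; by continuity it
  -- fixes every `S`-invariant smooth form.
  obtain ⟨μ, _, hμ, hinv⟩ := exists_isProbabilityMeasure_map_mul_right_eq S.topologicalClosure
    S.isClosed_topologicalClosure
  have hgood := isGoodAverage E M F μ
  let avg {k : ℕ} (α : Form E M k) : InvForm E M S k :=
    ⟨⟨integralForm μ (translate α.1), hgood.isSmooth α.2⟩, fun s hs ↦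
      pullback_integralForm_translate F (hinv s (S.le_topologicalClosure hs)) α.2⟩
  constructor
  · refine cohomologyMap_injective fun a ha hab ↦ ?_
    cases k with
    -- In degree 0 the only coboundary is 0 in either complex.
    | zero => exact Subtype.ext hab
    | succ k =>
      obtain ⟨β, hβ⟩ := hab
      refine ⟨avg β, Subtype.ext (Subtype.ext ?_)⟩
      have h1 : rawD β.1 = a.1.1 := congrArg Subtype.val hβ
      -- Averaging the primitive: d(avg β) = avg(dβ) = avg(a) = a.
      refine (hgood.rawD_eq β.2).trans ?_
      rw [h1]
      refine integralForm_translate_eq_self ?_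
      filter_upwards [mem_ae_iff.2 hμ] with g hg
      exact translate_eq_of_mem_closure F a.1.2 a.2 hg
  · refine cohomologyMap_surjective fun α hα ↦ ?_
    have hd : rawD α.1 = 0 := congrArg Subtype.val hα
    refine ⟨avg α, Subtype.ext (Subtype.ext ?_), mem_coboundaries_of_mem_exactForms ?_⟩
    · refine (hgood.rawD_eq α.2).trans ?_
      rw [hd]
      exact RawForm.ext_at fun x ↦ integral_zero T _
    · have h := hgood.sub_mem α.2 hd
      rwa [probReal_univ, one_smul, translate_one] at h

end DeRham

end

open DeRham in
theorem mainTheorem3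
    {F : Type*} [NormedAddCommGroup F] [NormedSpace ℝ F] [FiniteDimensional ℝ F]
    {T : Type*} [Group T] [TopologicalSpace T] [ChartedSpace F T] [LieGroup 𝓘(ℝ, F) ∞ T]
    [CompactSpace T] [ConnectedSpace T]
    {E : Type*} [NormedAddCommGroup E] [NormedSpace ℝ E] [FiniteDimensional ℝ E]
    {M : Type*} [TopologicalSpace M] [T2Space M] [SecondCountableTopology M]
    [ChartedSpace E M] [IsManifold 𝓘(ℝ, E) ∞ M]
    [MulAction T M] [ContMDiffSMul 𝓘(ℝ, F) 𝓘(ℝ, E) ∞ T M]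
    (S : Subgroup T) (k : ℕ) :
    (∃ e : InvCohomology F E M S k ≃ₗ[ℝ] DeRhamCohomology E M k,
      e.toLinearMap = invCohomologyToDeRham F E M S k) ∧
    (∃ e : InvCohomology F E M (⊤ : Subgroup T) k ≃ₗ[ℝ] InvCohomology F E M S k,
      e.toLinearMap = invCohomologyOfLE F E M (le_top : S ≤ ⊤) k) := by
  have hS := bijective_invCohomologyToDeRham F E M S k
  have hT := bijective_invCohomologyToDeRham F E M (⊤ : Subgroup T) k
  -- The inclusion of `⊤`-invariant forms into all forms factors through the `S`-invariant ones, so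
  -- two bijections force the third.
  have hcomp : (invCohomologyToDeRham F E M S k) ∘ₗ
      (invCohomologyOfLE F E M (le_top : S ≤ ⊤) k) =
      invCohomologyToDeRham F E M (⊤ : Subgroup T) k := by
    refine LinearMap.ext fun q ↦ ?_
    obtain ⟨a, rfl⟩ := Submodule.Quotient.mk_surjective _ q
    rfl
  rw [← hcomp, LinearMap.coe_comp] at hT
  exact ⟨⟨LinearEquiv.ofBijective _ hS, rfl⟩,
    ⟨LinearEquiv.ofBijective _ ((Function.Bijective.of_comp_iff' hS _).1 hT), rfl⟩⟩
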